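/- A $d$-dimensional brick is a $d$-tuple $B=(b_1,\dots,b_d)$ of positive integers, identified with $[0,b_1)\times\cdots\times[0,b_d)\subset\mathbb R^d$. For a finite set $\mathcal P$ of $d$-dimensional bricks ("protobricks"), a brick $T$ is tilable by $\mathcal P$ if its indicator function is a finite integer linear combination of indicator functions of translates (by vectors of $\mathbb R^d$) of members of $\mathcal P$. Say that $B$ divides $T$ if $b_i\mid t_i$ for every $i$. Let $\operatorname{rank}(\mathcal P)$ be the number of bricks that are minimal, with respect to divisibility, among the bricks tilable by $\mathcal P$, and let $\operatorname{maxrank}(n,d)$ be the maximum of $\operatorname{rank}(\mathcal P)$ over all sets $\mathcal P$ of exactly $n$ bricks of dimension $d$. Let $D$ be the free distributive lattice (without adjoined top or bottom) on letters $w_1,w_2,\dots$, realised as the lattice of all Boolean functions built from the variables $w_1,w_2,\dots$ by AND and OR, and let $\Lambda[\infty,\infty]=D\times D\times\cdots$ be the product of countably many copies of $D$, with the coordinatewise order. For a non-empty finite set $A\subset\Lambda[\infty,\infty]$ and a direction $i$, let $\operatorname{comb}_i(A)$ be the element whose $i$-th coordinate is the infimum of the $i$-th coordinates of the members of $A$,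 and whose $j$-th coordinate, for each $j\ne i$, is the supremum of their $j$-th coordinates. For a set $S$ let $\operatorname{ext}_i(S)$ be the set of all $\operatorname{comb}_i(A)$ with $A$ a non-empty finite subset of $S$. With $W_k=(w_k,w_k,\dots)$, an element is $n,d$-good if it lies in $\operatorname{ext}_d(\cdots\operatorname{ext}_1(\{W_1,\dots,W_n\})\cdots)$, it is good if it is $n,d$-good for some $n,d$, and it is $n,d$-minimal if it is $n,d$-good and is minimal among all good elements. Theorem (Polynomial Conjecture). For every integer $n\ge 1$ there is a polynomial $p_n\in\mathbb Q[x]$ of degree exactly $n-1$ such that (i) for every integer $d\ge 2$ the maximum $\operatorname{maxrank}(n,d)$ exists (and is finite), and $\operatorname{maxrank}(n,d)=p_n(d)$; (ii) for every integer $d\ge 0$ the set of $n,d$-minimal elements of $\Lambda[\infty,\infty]$ is finite and has exactly $p_n(d)$ elements. -/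

import Mathlib

/-! ### Bricks, tilings and rank -/

/-- A `d`-dimensional brick: a `d`-tuple of positive integer sidelengths. -/
abbrev Brick (d : ℕ) := Fin d → ℕ+

namespace Brick

/-- The brick as the subset `[0,b₁) × ⋯ × [0,b_d)` of `ℝᵈ`. -/
def region {d : ℕ} (b : Brick d) : Set (Fin d → ℝ) :=
  {y | ∀ i, 0 ≤ y i ∧ y i < ((b i : ℕ) : ℝ)}

/-- The translate `b + w` of a brick by a vector `w`. -/
def translate {d : ℕ} (b : Brick d) (w : Fin d → ℝ) : Set (Fin d → ℝ) :=
  (fun y => y + w) '' b.region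

/-- `b` divides `t`: every sidelength of `b` divides the corresponding sidelength of `t`. -/
def Divides {d : ℕ} (b t : Brick d) : Prop :=
  ∀ i, (b i : ℕ) ∣ (t i : ℕ)

/-- `t` is (integrally) tilable by the set `P` of protobricks: the indicator function of `t` is an
integer linear combination of the indicator functions of finitely many translates of
members of `P`. -/
def Tilable {d : ℕ} (P : Finset (Brick d)) (t : Brick d) : Prop :=
  ∃ (s : Finset (Brick d × (Fin d → ℝ))) (γ : Brick d × (Fin d → ℝ) → ℤ),
    (∀ h ∈ s, h.1 ∈ P) ∧
    ∀ y : Fin d → ℝ,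
      t.region.indicator (fun _ => (1 : ℤ)) y =
        ∑ h ∈ s, γ h * (h.1.translate h.2).indicator (fun _ => (1 : ℤ)) y

/-- The divisibility-minimal boxes among the boxes tilable by `P`. -/
def minimalTilable {d : ℕ} (P : Finset (Brick d)) : Set (Brick d) :=
  {t | Tilable P t ∧ ∀ b : Brick d, Tilable P b → b.Divides t → b = t}

/-- The rank of a set of protobricks: the number of minimal tilable boxes. -/
noncomputable def rank {d : ℕ} (P : Finset (Brick d)) : ℕ∞ :=
  (minimalTilable P).encard

/-- `r` is the maximum of `rank P` as `P` ranges over all sets of exactly `n` bricks of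
dimension `d`, that is, `r = maxrank(n,d)`. -/
def IsMaxrank (n d : ℕ) (r : ℕ∞) : Prop :=
  IsGreatest {k : ℕ∞ | ∃ P : Finset (Brick d), P.card = n ∧ rank P = k} r

end Brick

/-! ### The lattice setting -/

/-- The `k`-th letter, viewed as a Boolean function: an assignment of truth values to the letters
is the set `S` of the letters that are true. -/
def letterFn (k : ℕ) : Set ℕ → Prop := fun S => k ∈ S

/-- The free distributive lattice (without adjoined constants) on the letters `0, 1, 2, …`: the
lattice of Boolean functions built from the letters by AND (`⊓`) and OR (`⊔`). -/
def dedekindSublattice : Sublattice (Set ℕ → Prop) where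
  carrier := latticeClosure (Set.range letterFn)
  supClosed' := isSublattice_latticeClosure.supClosed
  infClosed' := isSublattice_latticeClosure.infClosed

/-- The free distributive lattice on the letters, as a type. -/
abbrev DedekindLattice : Type := ↥dedekindSublattice

/-- The `k`-th generator of the free distributive lattice. -/
def letter (k : ℕ) : DedekindLattice :=
  ⟨letterFn k, subset_latticeClosure (Set.mem_range_self k)⟩

/-- Infinite-dimensional bricks: the elements of the infinite product of copies of the free
distributive lattice on countably many letters, ordered coordinatewise. Directions are numbered
from `0`. -/
abbrev LatticeBrick := ℕ → DedekindLattice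

namespace LatticeBrick

/-- The combine of a non-empty finite set of bricks in direction `i`: infimum in direction `i`,
supremum in every other direction. -/
noncomputable def comb (i : ℕ) (A : Finset LatticeBrick) (hA : A.Nonempty) : LatticeBrick :=
  fun j => if j = i then A.inf' hA (fun b => b j) else A.sup' hA (fun b => b j)

/-- The `i`-th extension of a set of bricks: all combines in direction `i` of its non-empty finite
subsets. -/
def ext (i : ℕ) (S : Set LatticeBrick) : Set LatticeBrick :=
  {b | ∃ (A : Finset LatticeBrick) (hA : A.Nonempty), (A : Set LatticeBrick) ⊆ S ∧ b = comb i A hA}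

/-- The cube all of whose sidelengths are the `k`-th letter. -/
def cube (k : ℕ) : LatticeBrick := fun _ => letter k

/-- The `n,d`-good bricks: those obtained from the cubes over the first `n` letters by applying the
extension operators in the first `d` directions. -/
def good (n : ℕ) : ℕ → Set LatticeBrick
  | 0 => {b | ∃ k, k < n ∧ b = cube k}
  | d + 1 => ext d (good n d)

/-- A brick is good if it is `n,d`-good for some `n` and `d`. -/
def IsGood (b : LatticeBrick) : Prop := ∃ n d, b ∈ good n d

/-- The `n,d`-minimal bricks: the `n,d`-good bricks that are minimal among all good bricks. -/
def minimalBricks (n d : ℕ) : Set LatticeBrick :=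
  {b | b ∈ good n d ∧ Minimal IsGood b}

end LatticeBrick

/-! ### Elements of the free distributive lattice as monotone Boolean functions -/

namespace DedekindLattice

/-! Lattice elements are treated as non-constant monotone Boolean functions. A good brick is
`Unavoidable`: however the letters are distributed over the directions, some coordinate is satisfied
by the letters placed in its direction (`unavoidable_of_mem_good`). Conversely, every eventually
constant unavoidable brick dominates a good one (`Unavoidable.exists_good_le`). So the minimal good
bricks are the minimal eventually constant unavoidable ones (`mem_minimalBricks_iff`), a description
symmetric in the directions although the extensions are applied in a fixed order.

By this symmetry, the number a_k of minimal bricks that differ from their final value exactly in k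
given directions depends only on k, and the count for d is the sum of d.choose k * a_k. A Hall-type
matching argument gives a_k = 0 for k ≥ n (`card_lt_of_mem_minimalActive`); a threshold brick gives
a_{n-1} > 0 (`minimalActive_range_nonempty`). Hence a polynomial of degree n-1.

Substituting protobricks for letters, with gcd as meet and lcm as join, turns good bricks into
tilable boxes, since the admissible lengths in one direction form a subgroup of ℤ. Conversely, the
divisibility obstruction `Tilable.exists_dvd` says that a tilable box defines an unavoidable brick,
so the value of some minimal brick divides it. This bounds the rank by the count. Equality holds for
d ≥ 2: suitable products of primes make divisibility reflect the lattice order on the first d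
coordinates, and those truncations are pairwise incomparable (`eq_of_forall_lt_le`). -/

lemma ext_iff_holds {x y : DedekindLattice} : x = y ↔ ∀ X, x.1 X ↔ y.1 X :=
  ⟨fun h _ => h ▸ Iff.rfl, fun h => Subtype.ext (funext fun X => propext (h X))⟩

lemma sup_holds (x y : DedekindLattice) (X : Set ℕ) : (x ⊔ y).1 X ↔ x.1 X ∨ y.1 X := Iff.rfl

lemma inf_holds (x y : DedekindLattice) (X : Set ℕ) : (x ⊓ y).1 X ↔ x.1 X ∧ y.1 X := Iff.rfl

lemma letter_holds (k : ℕ) (X : Set ℕ) : (letter k).1 X ↔ k ∈ X := Iff.rfl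

lemma sup'_holds {ι : Type*} (A : Finset ι) (hA : A.Nonempty) (f : ι → DedekindLattice)
    (X : Set ℕ) : (A.sup' hA f).1 X ↔ ∃ a ∈ A, (f a).1 X := by
  classical
  induction hA using Finset.Nonempty.cons_induction with
  | singleton a => simp
  | cons a s ha hs ih => rw [Finset.sup'_cons hs, sup_holds, ih]; simp

lemma inf'_holds {ι : Type*} (A : Finset ι) (hA : A.Nonempty) (f : ι → DedekindLattice)
    (X : Set ℕ) : (A.inf' hA f).1 X ↔ ∀ a ∈ A, (f a).1 X := by
  classical
  induction hA using Finset.Nonempty.cons_induction with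
  | singleton a => simp
  | cons a s ha hs ih => rw [Finset.inf'_cons hs, inf_holds, ih]; simp

lemma mono_empty_univ (x : DedekindLattice) :
    (∀ X Y : Set ℕ, X ⊆ Y → x.1 X → x.1 Y) ∧ ¬ x.1 ∅ ∧ x.1 Set.univ := by
  obtain ⟨x, hx⟩ := x
  change x ∈ latticeClosure (Set.range letterFn) at hx
  induction hx using latticeClosure_sup_inf_induction with
  | mem a ha => obtain ⟨k, rfl⟩ := ha; exact ⟨fun X Y h hk => h hk, id, trivial⟩
  | sup a _ b _ iha ihb =>
    exact ⟨fun X Y h => Or.imp (iha.1 X Y h) (ihb.1 X Y h),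
      fun h => h.elim iha.2.1 ihb.2.1, Or.inl iha.2.2⟩
  | inf a _ b _ iha ihb =>
    exact ⟨fun X Y h => And.imp (iha.1 X Y h) (ihb.1 X Y h), fun h => iha.2.1 h.1,
      iha.2.2, ihb.2.2⟩

lemma mono (x : DedekindLattice) {X Y : Set ℕ} (h : X ⊆ Y) (hx : x.1 X) : x.1 Y :=
  x.mono_empty_univ.1 X Y h hx

lemma not_empty (x : DedekindLattice) : ¬ x.1 ∅ := x.mono_empty_univ.2.1

lemma univ (x : DedekindLattice) : x.1 Set.univ := x.mono_empty_univ.2.2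

/-- The element `x` is a function of the letters in `S` only. -/
def DependsOn (x : DedekindLattice) (S : Finset ℕ) : Prop := ∀ X, x.1 X ↔ x.1 (X ∩ S)

lemma DependsOn.of_inter_subset {x : DedekindLattice} {S : Finset ℕ} (hx : DependsOn x S)
    {X Y : Set ℕ} (h : X ∩ S ⊆ Y) (hX : x.1 X) : x.1 Y :=
  x.mono h ((hx X).1 hX)

lemma DependsOn.mono {x : DedekindLattice} {S T : Finset ℕ} (hx : DependsOn x S) (h : S ⊆ T) :
    DependsOn x T := fun X =>
  ⟨fun hX => x.mono (Set.inter_subset_inter_right _ (Finset.coe_subset.2 h)) ((hx X).1 hX),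
    fun hX => x.mono Set.inter_subset_left hX⟩

lemma DependsOn.holds_coe {x : DedekindLattice} {S : Finset ℕ} (hx : DependsOn x S) :
    x.1 (S : Set ℕ) := hx.of_inter_subset (X := Set.univ) (by simp) x.univ

/-- The disjunction of the letters in `S`. -/
noncomputable def orLetters (S : Finset ℕ) (hS : S.Nonempty) : DedekindLattice := S.sup' hS letter

lemma orLetters_holds (S : Finset ℕ) (hS : S.Nonempty) (X : Set ℕ) :
    (orLetters S hS).1 X ↔ ∃ k ∈ S, k ∈ X := by
  rw [orLetters, sup'_holds]; rfl

/-- The conjunction of the letters in `S`. -/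
noncomputable def andLetters (S : Finset ℕ) (hS : S.Nonempty) : DedekindLattice := S.inf' hS letter

lemma andLetters_holds (S : Finset ℕ) (hS : S.Nonempty) (X : Set ℕ) :
    (andLetters S hS).1 X ↔ ∀ k ∈ S, k ∈ X := by
  rw [andLetters, inf'_holds]; rfl

/-- The element that holds exactly where some member of the family `F` of sets of letters is
contained in the assignment. -/
noncomputable def ofFamily (F : Finset (Finset ℕ)) (hF : F.Nonempty) (h : ∀ A ∈ F, A.Nonempty) :
    DedekindLattice :=
  F.attach.sup' (Finset.attach_nonempty_iff.2 hF) fun A => andLetters A.1 (h A.1 A.2)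

lemma ofFamily_holds (F : Finset (Finset ℕ)) (hF : F.Nonempty) (h : ∀ A ∈ F, A.Nonempty)
    (X : Set ℕ) : (ofFamily F hF h).1 X ↔ ∃ A ∈ F, (A : Set ℕ) ⊆ X := by
  simp only [ofFamily, sup'_holds, andLetters_holds, Finset.mem_attach, true_and, Subtype.exists]
  exact ⟨fun ⟨A, hA, h⟩ => ⟨A, hA, fun k hk => h k hk⟩, fun ⟨A, hA, h⟩ => ⟨A, hA, fun k hk => h hk⟩⟩

end DedekindLattice

namespace LatticeBrick

open DedekindLattice

/-! ### Good bricks and unavoidable bricks -/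

lemma comb_self_holds (i : ℕ) (A : Finset LatticeBrick) (hA : A.Nonempty) (X : Set ℕ) :
    (comb i A hA i).1 X ↔ ∀ b ∈ A, (b i).1 X := by
  simp [comb, inf'_holds]

lemma comb_ne_holds {i j : ℕ} (hij : j ≠ i) (A : Finset LatticeBrick) (hA : A.Nonempty)
    (X : Set ℕ) : (comb i A hA j).1 X ↔ ∃ b ∈ A, (b j).1 X := by
  simp [comb, hij, sup'_holds]

/-- The bricks obtained from the cubes over the letters in `S` by applying the extension operators
in the first `d` directions. -/
def goodOver (S : Finset ℕ) : ℕ → Set LatticeBrick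
  | 0 => {b | ∃ k ∈ S, b = cube k}
  | d + 1 => ext d (goodOver S d)

lemma good_eq_goodOver (n d : ℕ) : good n d = goodOver (Finset.range n) d := by
  induction d with
  | zero => ext b; simp [good, goodOver]
  | succ d ih => rw [good, goodOver, ih]

lemma goodOver_mono {S T : Finset ℕ} (h : S ⊆ T) (d : ℕ) : goodOver S d ⊆ goodOver T d := by
  induction d with
  | zero => rintro b ⟨k, hk, rfl⟩; exact ⟨k, h hk, rfl⟩
  | succ d ih => rintro b ⟨A, hA, hAS, rfl⟩; exact ⟨A, hA, hAS.trans ih, rfl⟩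

lemma good_finite (n d : ℕ) : (good n d).Finite := by
  classical
  induction d with
  | zero =>
    refine ((Finset.range n).finite_toSet.image cube).subset ?_
    rintro b ⟨k, hk, rfl⟩
    exact ⟨k, by simpa using hk, rfl⟩
  | succ d ih =>
    refine ((ih.toFinset.powerset.finite_toSet).image
      fun A => if hA : A.Nonempty then comb d A hA else cube 0).subset ?_
    rintro b ⟨A, hA, hAS, rfl⟩
    exact ⟨A, by simpa [Finset.subset_iff] using hAS, by simp [hA]⟩

/-- Every good brick is a function of its support: the letters whose disjunction is the common
value of its last coordinates. -/
lemma exists_support {T : Finset ℕ} {d : ℕ} {b : LatticeBrick} (hb : b ∈ goodOver T d) :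
    ∃ S ⊆ T, S.Nonempty ∧ b ∈ goodOver S d ∧ (∀ j, DependsOn (b j) S) ∧
      ∀ j, d ≤ j → ∀ X, (b j).1 X ↔ ∃ k ∈ S, k ∈ X := by
  classical
  induction d generalizing b with
  | zero =>
    obtain ⟨k, hk, rfl⟩ := hb
    refine ⟨{k}, by simpa using hk, by simp, ⟨k, by simp, rfl⟩, fun j X => ?_, fun j _ X => ?_⟩
    · simp [cube, letter_holds]
    · simp [cube, letter_holds]
  | succ d ih =>
    obtain ⟨A, hA, hAS, rfl⟩ := hb
    choose! S hST hSn hSb hSd hSt using fun b (hb : b ∈ A) => ih (hAS hb)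
    have hsub : ∀ b ∈ A, S b ⊆ A.biUnion S := fun b hb => Finset.subset_biUnion_of_mem S hb
    have hSne : (A.biUnion S).Nonempty :=
      hA.elim fun a ha => (hSn a ha).mono (hsub a ha)
    refine ⟨A.biUnion S, Finset.biUnion_subset.2 hST, hSne,
      ⟨A, hA, fun b hb => goodOver_mono (hsub b hb) d (hSb b hb), rfl⟩, fun j X => ?_,
      fun j hj X => ?_⟩
    · have h : ∀ b ∈ A, ((b j).1 X ↔ (b j).1 (X ∩ (A.biUnion S : Finset ℕ))) :=
        fun b hb => ((hSd b hb j).mono (hsub b hb)) X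
      rcases eq_or_ne j d with rfl | hj
      · rw [comb_self_holds, comb_self_holds]
        exact forall₂_congr h
      · rw [comb_ne_holds hj, comb_ne_holds hj]
        exact exists_congr fun b => and_congr_right (h b)
    · rw [comb_ne_holds (by omega)]
      constructor
      · rintro ⟨b, hb, h⟩
        obtain ⟨k, hk, hkX⟩ := (hSt b hb j (by omega) X).1 h
        exact ⟨k, hsub b hb hk, hkX⟩
      · rintro ⟨k, hk, hkX⟩
        obtain ⟨b, hb, hkb⟩ := Finset.mem_biUnion.1 hk
        exact ⟨b, hb, (hSt b hb j (by omega) X).2 ⟨k, hkb, hkX⟩⟩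

/-- The letters below `n` that `f` sends to direction `i`. -/
def fibre (n : ℕ) (f : ℕ → ℕ) (i : ℕ) : Set ℕ := {k | k < n ∧ f k = i}

/-- However the first `n` letters are distributed over the directions, in some direction the
conjunction of the letters there lies below the coordinate of `b`. -/
def Unavoidable (n : ℕ) (b : LatticeBrick) : Prop :=
  ∀ f : ℕ → ℕ, ∃ i, (b i).1 (fibre n f i)

lemma Unavoidable.mono {n : ℕ} {b c : LatticeBrick} (hb : Unavoidable n b) (h : b ≤ c) :
    Unavoidable n c := fun f => (hb f).imp fun i hi => h i _ hi

lemma unavoidable_of_mem_good {n d : ℕ} {b : LatticeBrick} (hb : b ∈ good n d) :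
    Unavoidable n b := by
  induction d generalizing b with
  | zero =>
    obtain ⟨k, hk, rfl⟩ := hb
    exact fun f => ⟨f k, hk, rfl⟩
  | succ d ih =>
    obtain ⟨A, hA, hAS, rfl⟩ := hb
    intro f
    by_cases h : ∃ b ∈ A, ∃ i ≠ d, (b i).1 (fibre n f i)
    · obtain ⟨b, hb, i, hi, hbi⟩ := h
      exact ⟨i, (comb_ne_holds hi A hA _).2 ⟨b, hb, hbi⟩⟩
    · push Not at h
      refine ⟨d, (comb_self_holds d A hA _).2 fun b hb => ?_⟩
      obtain ⟨i, hi⟩ := ih (hAS hb) f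
      by_cases hid : i = d
      · exact hid ▸ hi
      · exact absurd hi (h b hb i hid)

/-- If no distribution of the letters in `Q` over the first `d` directions avoids `t`, then `t`
dominates in these directions a brick that is good over `Q`. -/
lemma exists_goodOver_le (d : ℕ) (Q : Finset ℕ) (t : LatticeBrick)
    (h : ∀ f : ℕ → ℕ, (∀ k ∈ Q, f k < d) → ∃ i < d, (t i).1 {k | k ∈ Q ∧ f k = i}) :
    ∃ c ∈ goodOver Q d, ∀ i < d, c i ≤ t i := by
  classical
  induction d generalizing Q with
  | zero =>
    obtain rfl | ⟨k, hk⟩ := Q.eq_empty_or_nonempty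
    · simpa using h id
    · exact ⟨cube k, ⟨k, hk, rfl⟩, by simp⟩
  | succ d ih =>
    -- `ok R` says that `t` is already unavoidable for the letters of `R` in the first `d`
    -- directions. The witness combines, in direction `d`, the inductively given good bricks of all
    -- such `R`.
    let ok : Finset ℕ → Prop := fun R =>
      ∀ f : ℕ → ℕ, (∀ k ∈ R, f k < d) → ∃ i < d, (t i).1 {k | k ∈ R ∧ f k = i}
    -- Distribute `R` so as to avoid `t` and send the rest of `Q` to direction `d`: only coordinate
    -- `d` can then be satisfied.
    have key : ∀ R ⊆ Q, ¬ ok R → (t d).1 {k | k ∈ Q ∧ k ∉ R} := by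
      intro R hR hok
      simp only [ok] at hok
      push Not at hok
      obtain ⟨f, hf, hft⟩ := hok
      obtain ⟨i, hi, hti⟩ := h (fun k => if k ∈ R then f k else d) (by
        intro k hk
        by_cases hkR : k ∈ R
        · simpa [hkR] using (hf k hkR).trans (Nat.lt_succ_self d)
        · simp [hkR])
      obtain hid | rfl := Nat.lt_succ_iff_lt_or_eq.1 hi
      · refine absurd ((t i).mono ?_ hti) (hft i hid)
        rintro k ⟨hkQ, hk⟩
        by_cases hkR : k ∈ R
        · simpa [hkR] using hk
        · simp only [hkR, if_false] at hk; omega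
      · refine (t i).mono ?_ hti
        rintro k ⟨hkQ, hk⟩
        refine ⟨hkQ, fun hkR => ?_⟩
        simp only [hkR, if_true] at hk
        exact absurd (hf k hkR) (by omega)
    have : Nonempty LatticeBrick := ⟨cube 0⟩
    choose! c hc hct using fun (R : Finset ℕ) (hR : ok R) => ih R hR
    have hne : (Q.powerset.filter ok).Nonempty := by
      refine ⟨Q, by_contra fun hQ => ?_⟩
      have := key Q subset_rfl (by simpa using hQ)
      exact (t d).not_empty ((t d).mono (by rintro k ⟨h1, h2⟩; exact absurd h1 h2) this)
    have hmem : ∀ b ∈ (Q.powerset.filter ok).image c, ∃ R ⊆ Q, ok R ∧ c R = b := by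
      intro b hb
      obtain ⟨R, hR, rfl⟩ := Finset.mem_image.1 hb
      simp only [Finset.mem_filter, Finset.mem_powerset] at hR
      exact ⟨R, hR.1, hR.2, rfl⟩
    refine ⟨comb d ((Q.powerset.filter ok).image c) (hne.image c), ⟨_, _, ?_, rfl⟩, ?_⟩
    · intro b hb
      obtain ⟨R, hRQ, hR, rfl⟩ := hmem b hb
      exact goodOver_mono hRQ d (hc R hR)
    · intro i hi X hX
      obtain hid | rfl := Nat.lt_succ_iff_lt_or_eq.1 hi
      · obtain ⟨b, hb, hbX⟩ := (comb_ne_holds hid.ne _ _ X).1 hX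
        obtain ⟨R, hRQ, hR, rfl⟩ := hmem b hb
        exact hct R hR i hid X hbX
      · rw [comb_self_holds] at hX
        -- Take `R` to be the letters of `Q` false under `X`. If it were `ok`, its good brick, a
        -- function of false letters only, would hold at `X`.
        refine (t i).mono ?_ (key (Q.filter (· ∉ X)) (Finset.filter_subset _ _) fun hok => ?_)
        · rintro k ⟨hkQ, hk⟩
          by_contra hkX
          exact hk (Finset.mem_filter.2 ⟨hkQ, hkX⟩)
        · have := hX (c (Q.filter (· ∉ X)))
            (Finset.mem_image_of_mem c (by simpa using hok))
          obtain ⟨S, hSQ, -, -, hdep, -⟩ := exists_support (hc _ hok)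
          refine (c (Q.filter (· ∉ X)) i).not_empty ((hdep i).of_inter_subset ?_ this)
          rintro k ⟨hkX, hkS⟩
          exact (Finset.mem_filter.1 (hSQ hkS)).2 hkX

/-- The brick `b` is constant from direction `d` on. -/
def ConstFrom (d : ℕ) (b : LatticeBrick) : Prop := ∀ j, d ≤ j → b j = b d

lemma ConstFrom.mono {d e : ℕ} {b : LatticeBrick} (h : ConstFrom d b) (hde : d ≤ e) :
    ConstFrom e b := fun j hj => (h j (hde.trans hj)).trans (h e hde).symm

lemma constFrom_of_mem_good {n d : ℕ} {b : LatticeBrick} (hb : b ∈ good n d) : ConstFrom d b := by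
  rw [good_eq_goodOver] at hb
  obtain ⟨S, -, -, -, -, h⟩ := exists_support hb
  exact fun j hj => ext_iff_holds.2 fun X => (h j hj X).trans (h d le_rfl X).symm

/-- Every unavoidable brick that is eventually constant dominates a good brick. -/
lemma Unavoidable.exists_good_le {n d : ℕ} {t : LatticeBrick} (ht : Unavoidable n t)
    (hd : ConstFrom d t) : ∃ c ∈ good n d, c ≤ t := by
  classical
  let Q := (Finset.range n).filter fun k => (t d).1 {k}
  obtain ⟨c, hc, hct⟩ := exists_goodOver_le d Q t (by
    intro f hf
    -- Each letter outside `Q` gets a tail direction of its own, where by definition of `Q` it does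
    -- not satisfy `t`.
    obtain ⟨i, hi⟩ := ht fun k => if k ∈ Q then f k else d + k
    have hid : i < d := by
      by_contra hid
      have hsub : fibre n (fun k => if k ∈ Q then f k else d + k) i ⊆ {i - d} := by
        rintro k ⟨hk, hki⟩
        by_cases hkQ : k ∈ Q
        · simp only [hkQ, if_true] at hki
          exact absurd (hf k hkQ) (by omega)
        · simp only [hkQ, if_false] at hki
          rw [Set.mem_singleton_iff]; omega
      obtain hempty | hmem := Set.subset_singleton_iff_eq.1 hsub
      · exact (t i).not_empty (hempty ▸ hi)
      · have hk : i - d ∈ fibre n (fun k => if k ∈ Q then f k else d + k) i := by rw [hmem]; rfl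
        rw [hmem, hd i (by omega)] at hi
        have hkQ : i - d ∈ Q := Finset.mem_filter.2 ⟨Finset.mem_range.2 hk.1, hi⟩
        have := hk.2
        simp only [hkQ, if_true] at this
        exact absurd (hf _ hkQ) (by omega)
    refine ⟨i, hid, (t i).mono ?_ hi⟩
    rintro k ⟨hk, hki⟩
    by_cases hkQ : k ∈ Q
    · simp only [hkQ, if_true] at hki; exact ⟨hkQ, hki⟩
    · simp only [hkQ, if_false] at hki; omega)
  refine ⟨c, good_eq_goodOver n d ▸ goodOver_mono (Finset.filter_subset _ _) d hc, fun i => ?_⟩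
  by_cases hid : i < d
  · exact hct i hid
  · intro X hX
    obtain ⟨S, hSQ, -, -, -, htail⟩ := exists_support hc
    obtain ⟨k, hk, hkX⟩ := (htail i (by omega) X).1 hX
    rw [hd i (by omega)]
    exact (t d).mono (by simpa using hkX) (Finset.mem_filter.1 (hSQ hk)).2

/-- The unavoidable bricks that are constant outside a finite set of directions. -/
def IsEventual (n : ℕ) (b : LatticeBrick) : Prop :=
  Unavoidable n b ∧ ∃ s, {j | b j ≠ s}.Finite

lemma exists_constFrom {b : LatticeBrick} {s : DedekindLattice} (h : {j | b j ≠ s}.Finite)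
    (e : ℕ) : ∃ d, e ≤ d ∧ ConstFrom d b ∧ b d = s := by
  obtain ⟨m, hm⟩ := h.bddAbove
  have key : ∀ j, m + 1 ≤ j → b j = s := fun j hj => by
    by_contra hne
    have := hm (show j ∈ {j | b j ≠ s} from hne)
    omega
  exact ⟨max e (m + 1), le_max_left _ _, fun j hj => by
    rw [key j ((le_max_right _ _).trans hj), key _ (le_max_right _ _)], key _ (le_max_right _ _)⟩

lemma ConstFrom.finite_ne {d : ℕ} {b : LatticeBrick} (h : ConstFrom d b) :
    {j | b j ≠ b d}.Finite :=
  (Set.finite_lt_nat d).subset fun j hj => by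
    by_contra hd
    exact hj (h j (not_lt.1 hd))

lemma IsEventual.of_mem_good {n d : ℕ} {b : LatticeBrick} (hb : b ∈ good n d) : IsEventual n b :=
  ⟨unavoidable_of_mem_good hb, b d, (constFrom_of_mem_good hb).finite_ne⟩

/-- Coordinate `d` is the disjunction of the support, so its singletons reveal which letters are
really used. -/
lemma good_of_support {n N d : ℕ} {b : LatticeBrick} (hb : b ∈ good N d)
    (h : ∀ k, (b d).1 {k} → k < n) : b ∈ good n d := by
  rw [good_eq_goodOver] at hb ⊢
  obtain ⟨S, -, -, hS, -, ht⟩ := exists_support hb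
  refine goodOver_mono (fun k hk => ?_) d hS
  exact Finset.mem_range.2 (h k ((ht d le_rfl {k}).2 ⟨k, hk, rfl⟩))

lemma lt_of_mem_good {n d j k : ℕ} {b : LatticeBrick} (hb : b ∈ good n d) (h : (b j).1 {k}) :
    k < n := by
  rw [good_eq_goodOver] at hb
  obtain ⟨S, hSn, -, -, hdep, -⟩ := exists_support hb
  by_contra hk
  refine (b j).not_empty ((hdep j).of_inter_subset ?_ h)
  rintro l ⟨rfl, hl⟩
  exact absurd (Finset.mem_range.1 (hSn hl)) hk

/-- The `n,d`-minimal bricks are the minimal eventually constant unavoidable bricks that are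
constant from direction `d` on. -/
lemma mem_minimalBricks_iff {n d : ℕ} {b : LatticeBrick} :
    b ∈ minimalBricks n d ↔ Minimal (IsEventual n) b ∧ ConstFrom d b := by
  constructor
  · rintro ⟨hb, hmin⟩
    refine ⟨⟨.of_mem_good hb, fun c hc hcb => ?_⟩, constFrom_of_mem_good hb⟩
    obtain ⟨s, hs⟩ := hc.2
    obtain ⟨e, -, he, -⟩ := exists_constFrom hs 0
    obtain ⟨c', hc', hcc⟩ := hc.1.exists_good_le he
    exact (hmin.2 ⟨n, e, hc'⟩ (hcc.trans hcb)).trans hcc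
  · rintro ⟨hmin, hd⟩
    obtain ⟨c, hc, hcb⟩ := hmin.1.1.exists_good_le hd
    obtain rfl := le_antisymm hcb (hmin.2 (.of_mem_good hc) hcb)
    refine ⟨hc, ⟨n, d, hc⟩, ?_⟩
    rintro e ⟨N, D, he⟩ hec
    refine hmin.2 (.of_mem_good (good_of_support he fun k hk => ?_)) hec
    exact lt_of_mem_good hc (hec D _ hk)

lemma Unavoidable.not_avoid {n : ℕ} {b : LatticeBrick} (hb : Unavoidable n b) (f : ℕ → ℕ)
    (h : ∀ i, ¬ (b i).1 (fibre n f i)) : False :=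
  let ⟨i, hi⟩ := hb f
  h i hi

end LatticeBrick

namespace LatticeBrick

open DedekindLattice

/-! ### Minimal bricks and their truncations -/

lemma exists_support_of_mem_good {n d : ℕ} {b : LatticeBrick} (hb : b ∈ good n d) :
    ∃ S ⊆ Finset.range n, S.Nonempty ∧ (∀ j, DependsOn (b j) S) ∧
      ∀ j, d ≤ j → ∀ X, (b j).1 X ↔ ∃ k ∈ S, k ∈ X := by
  rw [good_eq_goodOver] at hb
  obtain ⟨S, h1, h2, -, h3⟩ := exists_support hb
  exact ⟨S, h1, h2, h3⟩

/-- A minimal element of the finite set `good n d` is minimal even against bricks that become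
constant only later: any such smaller brick can be turned into one constant from direction `d`. -/
lemma Unavoidable.exists_minimalBricks_le {n d : ℕ} {t : LatticeBrick} (ht : Unavoidable n t)
    (hd : ConstFrom d t) : ∃ b ∈ minimalBricks n d, b ≤ t := by
  classical
  obtain ⟨c, hc, hct⟩ := ht.exists_good_le hd
  obtain ⟨m, hmc, hm⟩ := (good_finite n d).exists_le_minimal hc
  have hmin : ∀ e, Unavoidable n e → ConstFrom d e → e ≤ m → m ≤ e := by
    intro e he hed hem
    obtain ⟨c', hc', hce⟩ := he.exists_good_le hed
    exact (hm.2 hc' (hce.trans hem)).trans hce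
  refine ⟨m, mem_minimalBricks_iff.2 ⟨⟨.of_mem_good hm.1, ?_⟩, constFrom_of_mem_good hm.1⟩,
    hmc.trans hct⟩
  intro e₀ he₀ hem₀
  obtain ⟨s, hs⟩ := he₀.2
  obtain ⟨D, hD, heD, -⟩ := exists_constFrom hs d
  obtain ⟨e, he, hee⟩ := he₀.1.exists_good_le heD
  have hem := hee.trans hem₀
  refine le_trans ?_ hee
  have hmd := constFrom_of_mem_good hm.1
  obtain ⟨S, hSn, hS, hSd, hSt⟩ := exists_support_of_mem_good hm.1
  have hed : ∀ j, DependsOn (e j) S := by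
    obtain ⟨R, -, -, hRd, hRt⟩ := exists_support_of_mem_good he
    refine fun j => (hRd j).mono fun k hk => ?_
    obtain ⟨l, hl, hlk⟩ := (hSt D hD {k}).1 (hem D _ ((hRt D le_rfl {k}).2 ⟨k, hk, rfl⟩))
    rw [Set.mem_singleton_iff] at hlk
    exact hlk ▸ hl
  have heu := unavoidable_of_mem_good he
  have hlow : ∀ i < d, m i ≤ e i := by
    -- Splice `e` below direction `d` with the constant tail of `m`.
    have := hmin (fun i => if i < d then e i else m i) (heu.mono fun i => by
      by_cases hi : i < d
      · simp [hi]
      · simpa [hi] using hem i) (fun j hj => by simp [hj.not_gt, hmd j hj]) (fun i => by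
      by_cases hi : i < d
      · simpa [hi] using hem i
      · simp [hi])
    intro i hi
    simpa [hi] using this i
  intro j
  by_cases hj : j < d
  · exact hlow j hj
  push Not at hj
  intro X hX
  by_contra heX
  obtain ⟨v, hv, hvX⟩ := (hSt j hj X).1 hX
  have hev : ¬ (e j).1 {v} := fun h => heX ((e j).mono (by simpa using hvX) h)
  have hne : (S.erase v).Nonempty := by
    rw [Finset.nonempty_iff_ne_empty, Ne, Finset.erase_eq_empty_iff]
    rintro (h | h)
    · exact hS.ne_empty h
    · exact hev (by simpa [h] using (hed j).holds_coe)
  -- Deleting `v` from the tail of `m` would keep it unavoidable, contradicting the minimality of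
  -- `m`.
  have hle := hmin (fun i => if i < d then m i else orLetters (S.erase v) hne) ?_
    (fun j hj => by simp [hj.not_gt]) ?_
  · have := hle d {v} ((hSt d le_rfl _).2 ⟨v, hv, rfl⟩)
    simp [orLetters_holds] at this
  · intro f
    by_contra hf
    push Not at hf
    have hlarge : ∀ i, d ≤ i → ∀ k ∈ S, k < n → f k = i → k = v := by
      intro i hi k hk hkn hki
      by_contra hkv
      have := hf i
      simp only [hi.not_gt, if_false, orLetters_holds] at this
      exact this ⟨k, Finset.mem_erase.2 ⟨hkv, hk⟩, hkn, hki⟩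
    -- Among letters of `S`, only `v` can lie in the tail. Moving it to direction `j`, where it does
    -- not satisfy `e`, avoids `e`.
    refine heu.not_avoid (fun k => if k = v ∧ d ≤ f k then j else f k) fun i hi => ?_
    by_cases hid : i < d
    · have := hf i
      simp only [hid, if_true] at this
      refine this (hem i _ ((e i).mono ?_ hi))
      rintro k ⟨hk, hki⟩
      refine ⟨hk, ?_⟩
      by_cases h : k = v ∧ d ≤ f k
      · have := hki.symm.trans (if_pos h); omega
      · simpa only [h, if_false] using hki
    · push Not at hid
      have hsub : ∀ k ∈ S, k ∈ fibre n (fun k => if k = v ∧ d ≤ f k then j else f k) i →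
          k = v ∧ i = j := by
        rintro k hkS ⟨hk, hki⟩
        by_cases h : k = v ∧ d ≤ f k
        · exact ⟨h.1, (hki.symm.trans (if_pos h))⟩
        · simp only [h, if_false] at hki
          exact absurd ⟨hlarge i hid k hkS hk hki, hki ▸ hid⟩ h
      by_cases hij : i = j
      · subst hij
        exact hev ((hed i).of_inter_subset (fun k hk => (hsub k hk.2 hk.1).1) hi)
      · exact (e i).not_empty ((hed i).of_inter_subset
          (fun k hk => absurd (hsub k hk.2 hk.1).2 hij) hi)
  · intro i Y hY
    by_cases hi : i < d
    · simpa [hi] using hY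
    · simp only [hi, if_false, orLetters_holds] at hY
      obtain ⟨k, hk, hkY⟩ := hY
      exact (hSt i (not_lt.1 hi) Y).2 ⟨k, Finset.mem_of_mem_erase hk, hkY⟩

lemma finite_ne_update {b : LatticeBrick} {s : DedekindLattice} (h : {j | b j ≠ s}.Finite) (i : ℕ)
    (x : DedekindLattice) : {j | Function.update b i x j ≠ s}.Finite := by
  refine (h.union (Set.finite_singleton i)).subset fun j hj => ?_
  by_cases hji : j = i
  · exact Or.inr hji
  · left; simpa [hji] using hj

/-- In at least two dimensions, minimal bricks are determined by their truncations, and these form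
an antichain. -/
lemma eq_of_forall_lt_le {n d : ℕ} (hd : 2 ≤ d) {b c : LatticeBrick} (hb : b ∈ minimalBricks n d)
    (hc : c ∈ minimalBricks n d) (h : ∀ i < d, b i ≤ c i) : b = c := by
  classical
  obtain ⟨S, hSn, hS, hSd, hSt⟩ := exists_support_of_mem_good hb.1
  obtain ⟨T, hTn, hT, hTd, hTt⟩ := exists_support_of_mem_good hc.1
  have hbm := (mem_minimalBricks_iff.1 hb).1
  have hcm := (mem_minimalBricks_iff.1 hc).1
  have hge : ∀ i < d, c i ≤ b i := by
    intro i hi X hcX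
    by_contra hbX
    -- Meeting `c i` with the disjunction of `R` makes it fail at `X`. By minimality of `c` some
    -- distribution `f` avoids the result: if its fibre over `i` satisfies `c i`, that fibre lies in
    -- `X`.
    let R := (Finset.range n).filter (· ∉ X)
    have hR : R.Nonempty := by
      rw [Finset.nonempty_iff_ne_empty]
      intro hR
      refine hbX (((hSd i).mono hSn).of_inter_subset (X := Set.univ) ?_ (b i).univ)
      rintro k ⟨-, hk⟩
      by_contra hkX
      have : k ∈ R := Finset.mem_filter.2 ⟨hk, hkX⟩
      simp [hR] at this
    have hnot : ¬ Unavoidable n (Function.update c i (c i ⊓ orLetters R hR)) := by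
      intro hu
      obtain ⟨s, hs⟩ := hcm.1.2
      have := hcm.2 ⟨hu, s, finite_ne_update hs i _⟩
        (update_le_iff.2 ⟨inf_le_left, fun _ _ => le_rfl⟩) i X hcX
      rw [Function.update_self, inf_holds, orLetters_holds] at this
      obtain ⟨-, k, hk, hkX⟩ := this
      exact (Finset.mem_filter.1 hk).2 hkX
    simp only [Unavoidable, not_forall, not_exists] at hnot
    obtain ⟨f, hf⟩ := hnot
    have hfi : ∀ j ≠ i, ¬ (c j).1 (fibre n f j) := fun j hj => by simpa [hj] using hf j
    have hfn : ∀ k ∈ T, k < n → f k < d := by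
      intro k hk hkn
      by_contra hkd
      exact hfi (f k) (by omega) ((hTt _ (not_lt.1 hkd) _).2 ⟨k, hk, hkn, rfl⟩)
    -- The letters that `f` sends to the tail are not in `T`, so `c` ignores them. They are parked
    -- in a direction other than `i`, which requires `2 ≤ d`.
    obtain ⟨j₁, hj₁, hji⟩ : ∃ j₁ < d, j₁ ≠ i := by
      by_cases hi0 : i = 0
      · exact ⟨1, by omega, by omega⟩
      · exact ⟨0, by omega, by omega⟩
    refine hbm.1.1.not_avoid (fun k => if f k < d then f k else j₁) fun j hj => ?_
    have hjd : j < d := by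
      by_contra hjd
      refine (b j).not_empty ((b j).mono ?_ hj)
      rintro k ⟨-, hk⟩
      by_cases hkd : f k < d
      · simp only [hkd, if_true] at hk; omega
      · simp only [hkd, if_false] at hk; omega
    by_cases hij : j = i
    · subst hij
      have hsub : fibre n (fun k => if f k < d then f k else j₁) j ⊆ fibre n f j := by
        rintro k ⟨hkn, hk⟩
        by_cases hkd : f k < d
        · simp only [hkd, if_true] at hk; exact ⟨hkn, hk⟩
        · simp only [hkd, if_false] at hk; exact absurd hk hji
      have hbj := (b j).mono hsub hj
      have hfj := hf j
      rw [Function.update_self, inf_holds, orLetters_holds] at hfj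
      refine hbX ((b j).mono (fun k hk => ?_) hbj)
      by_contra hkX
      exact hfj ⟨h j hi _ hbj, k, Finset.mem_filter.2 ⟨Finset.mem_range.2 hk.1, hkX⟩, hk⟩
    · refine hfi j hij ((hTd j).of_inter_subset ?_ (h j hjd _ hj))
      rintro k ⟨⟨hkn, hk⟩, hkT⟩
      simp only [hfn k hkT hkn, if_true] at hk
      exact ⟨hkn, hk⟩
  have heq : ∀ i < d, b i = c i := fun i hi => le_antisymm (h i hi) (hge i hi)
  have hdep : ∀ i < d, DependsOn (b i) (S ∩ T) := by
    intro i hi X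
    rw [hSd i, heq i hi, hTd i, hTd i (X ∩ _)]
    have : X ∩ (S : Set ℕ) ∩ T = X ∩ (S ∩ T : Finset ℕ) ∩ T := by ext; simp; tauto
    rw [this]
  have hne : (S ∩ T).Nonempty := by
    rw [Finset.nonempty_iff_ne_empty]
    intro h0
    exact (b 0).not_empty (by simpa [h0] using (hdep 0 (by omega)).holds_coe)
  -- With equal truncations, the common truncation followed by the disjunction of `S ∩ T` lies below
  -- both bricks, hence equals both.
  have he : IsEventual n fun i => if i < d then b i else orLetters (S ∩ T) hne := by
    refine ⟨fun f => ?_, orLetters (S ∩ T) hne, (Set.finite_lt_nat d).subset fun j hj => ?_⟩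
    · by_contra hf
      push Not at hf
      refine hbm.1.1.not_avoid (fun k => if f k < d then f k else 0) fun j hj => ?_
      have hjd : j < d := by
        by_contra hjd
        refine (b j).not_empty ((b j).mono ?_ hj)
        rintro k ⟨-, hk⟩
        by_cases hkd : f k < d
        · simp only [hkd, if_true] at hk; omega
        · simp only [hkd, if_false] at hk; omega
      have hfj := hf j
      simp only [hjd, if_true] at hfj
      refine hfj ((hdep j hjd).of_inter_subset ?_ hj)
      rintro k ⟨⟨hkn, hk⟩, hkST⟩
      refine ⟨hkn, ?_⟩
      by_cases hkd : f k < d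
      · simpa only [hkd, if_true] using hk
      · have := hf (f k)
        simp only [hkd, if_false, orLetters_holds] at this
        exact absurd ⟨k, hkST, hkn, rfl⟩ this
    · by_contra hjd
      have : ¬ j < d := hjd
      simp [this] at hj
  have hbe := hbm.eq_of_ge he fun i X hX => by
    by_cases hi : i < d
    · simpa [hi] using hX
    · simp only [hi, if_false, orLetters_holds] at hX
      obtain ⟨k, hk, hkX⟩ := hX
      exact (hSt i (not_lt.1 hi) X).2 ⟨k, (Finset.mem_inter.1 hk).1, hkX⟩
  have hce := hcm.eq_of_ge he fun i X hX => by
    by_cases hi : i < d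
    · simpa [hi, heq i hi] using hX
    · simp only [hi, if_false, orLetters_holds] at hX
      obtain ⟨k, hk, hkX⟩ := hX
      exact (hTt i (not_lt.1 hi) X).2 ⟨k, (Finset.mem_inter.1 hk).2, hkX⟩
  exact hbe.trans hce.symm

/-! ### Counting minimal bricks by their active directions -/

/-- The minimal bricks whose coordinates differ from their common final value exactly in the
directions in `I`. -/
def minimalActive (n : ℕ) (I : Finset ℕ) : Set LatticeBrick :=
  {b | Minimal (IsEventual n) b ∧ ∃ s, {j | b j ≠ s} = I}

/-- With at least as many active directions as letters in the support, a minimal deficient set of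
directions has a perfect matching to letters. Placing each letter in its matched direction, where it
alone is harmless, yields a distribution avoiding the brick. -/
lemma card_lt_of_mem_minimalActive {n : ℕ} {I : Finset ℕ} {b : LatticeBrick}
    (hb : b ∈ minimalActive n I) : I.card < n := by
  classical
  obtain ⟨hbm, s, hs⟩ := hb
  have hsI : ∀ j, j ∉ I ↔ b j = s := fun j => by
    rw [← Finset.mem_coe, ← hs]; simp
  obtain ⟨d, -, hbd, rfl⟩ := exists_constFrom (hs ▸ I.finite_toSet) 0
  obtain ⟨S, hSn, hS, hSd, hSt⟩ :=
    exists_support_of_mem_good (mem_minimalBricks_iff.2 ⟨hbm, hbd⟩).1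
  replace hSt := hSt d le_rfl
  refine lt_of_lt_of_le ?_ ((Finset.card_le_card hSn).trans_eq (Finset.card_range n))
  by_contra! hcard
  let N : ℕ → Finset ℕ := fun i => S.filter fun v => ¬ (b i).1 {v}
  have hN : ∀ i ∈ I, (N i).Nonempty := by
    intro i hi
    rw [Finset.nonempty_iff_ne_empty]
    intro h0
    refine absurd hi ((hsI i).2 (ext_iff_holds.2 fun X => ⟨fun hX => ?_, fun hX => ?_⟩))
    · rw [hSt]
      by_contra hX'
      refine (b i).not_empty ((hSd i).of_inter_subset ?_ hX)
      rintro k ⟨hkX, hkS⟩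
      exact hX' ⟨k, hkS, hkX⟩
    · obtain ⟨k, hk, hkX⟩ := (hSt X).1 hX
      by_contra hi
      have : k ∈ N i :=
        Finset.mem_filter.2 ⟨hk, fun h => hi ((b i).mono (by simpa using hkX) h)⟩
      simp [h0] at this
  have hI : I.Nonempty := Finset.card_pos.1 (hS.card_pos.trans_le hcard)
  -- By minimality, removing `v` from one tail coordinate makes the brick avoidable: the original
  -- fails to be avoided only because of `v` in that direction.
  have hcover : ∀ v ∈ S, ∃ (f : ℕ → ℕ) (j₀ : ℕ), j₀ ∉ I ∧ (∀ i ≠ j₀, ¬ (b i).1 (fibre n f i)) ∧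
      ∀ k ∈ S, k ∈ fibre n f j₀ → k = v := by
    intro v hv
    have hne : (S.erase v).Nonempty := by
      rw [Finset.nonempty_iff_ne_empty, Ne, Finset.erase_eq_empty_iff]
      rintro (h | rfl)
      · exact hS.ne_empty h
      · obtain ⟨i, hi⟩ := hI
        obtain ⟨w, hw⟩ := hN i hi
        obtain ⟨hwv, hw⟩ := Finset.mem_filter.1 hw
        rw [Finset.mem_singleton] at hwv
        exact hw (by simpa [hwv] using (hSd i).holds_coe)
    obtain ⟨j₀, hj₀⟩ := Infinite.exists_notMem_finset I
    have hnot : ¬ Unavoidable n (Function.update b j₀ (orLetters (S.erase v) hne)) := by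
      intro hu
      have := hbm.2 ⟨hu, b d, finite_ne_update (hs ▸ I.finite_toSet) _ _⟩
        (update_le_iff.2 ⟨fun X hX => ?_, fun _ _ => le_rfl⟩) j₀ {v}
        (by rw [(hsI j₀).1 hj₀, hSt]; exact ⟨v, hv, rfl⟩)
      · simp [orLetters_holds] at this
      · rw [(hsI j₀).1 hj₀, hSt]
        obtain ⟨k, hk, hkX⟩ := (orLetters_holds _ _ _).1 hX
        exact ⟨k, Finset.mem_of_mem_erase hk, hkX⟩
    simp only [Unavoidable, not_forall, not_exists] at hnot
    obtain ⟨f, hf⟩ := hnot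
    refine ⟨f, j₀, hj₀, fun i hi => by simpa [hi] using hf i, fun k hk hkf => ?_⟩
    by_contra hkv
    have := hf j₀
    rw [Function.update_self, orLetters_holds] at this
    exact this ⟨k, Finset.mem_erase.2 ⟨hkv, hk⟩, hkf⟩
  -- A smallest violator of strict expansion: equality holds for `J`, and Hall's condition holds
  -- inside it.
  obtain ⟨J, hJI, hJ, hJmin⟩ : ∃ J ⊆ I, (J.Nonempty ∧ (J.biUnion N).card ≤ J.card) ∧
      ∀ K ⊂ J, K.Nonempty → K.card < (K.biUnion N).card := by
    have hne : (I.powerset.filter fun J => J.Nonempty ∧ (J.biUnion N).card ≤ J.card).Nonempty :=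
      ⟨I, Finset.mem_filter.2 ⟨Finset.mem_powerset_self I, hI,
        (Finset.card_le_card (Finset.biUnion_subset.2 fun i _ => Finset.filter_subset _ _)).trans
          hcard⟩⟩
    obtain ⟨J, hJ, hmin⟩ := Finset.exists_min_image _ Finset.card hne
    simp only [Finset.mem_filter, Finset.mem_powerset] at hJ hmin
    refine ⟨J, hJ.1, hJ.2, fun K hK hKne => ?_⟩
    by_contra! hle
    exact absurd (hmin K ⟨hK.1.trans hJ.1, hKne, hle⟩) (Finset.card_lt_card hK).not_ge
  have hJcard : J.card ≤ (J.biUnion N).card := by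
    by_contra! hlt
    obtain ⟨j, hj⟩ := hJ.1
    have hsub := Finset.card_le_card (Finset.biUnion_subset_biUnion_of_subset_left N
      (Finset.erase_subset j J))
    have he := Finset.card_erase_of_mem hj
    obtain h0 | hne := (J.erase j).eq_empty_or_nonempty
    · have := (hN j (hJI hj)).card_pos
      have := Finset.card_le_card (Finset.subset_biUnion_of_mem N hj)
      rw [h0, Finset.card_empty] at he
      omega
    · have := hJmin _ (Finset.erase_ssubset hj) hne
      omega
  obtain ⟨g, hginj, hgN⟩ := (Finset.all_card_le_biUnion_card_iff_exists_injective
    fun x : J => N x).1 (by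
      intro K
      have hK : (K.biUnion fun x : J => N x) = (K.map (Function.Embedding.subtype _)).biUnion N := by
        ext; simp
      rw [hK, ← Finset.card_map (Function.Embedding.subtype (· ∈ J))]
      have hKJ : K.map (Function.Embedding.subtype _) ⊆ J := fun i hi => by
        obtain ⟨x, -, rfl⟩ := Finset.mem_map.1 hi
        exact x.2
      obtain heq | hss := hKJ.eq_or_ssubset
      · rw [heq]; exact hJcard
      · obtain h0 | hne := (K.map (Function.Embedding.subtype (· ∈ J))).eq_empty_or_nonempty
        · rw [h0]; simp
        · exact (hJmin _ hss hne).le)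
  have hgsurj : ∀ v ∈ J.biUnion N, ∃ x, g x = v := by
    have : Finset.univ.image g = J.biUnion N := by
      refine Finset.eq_of_subset_of_card_le (fun v hv => ?_) ?_
      · obtain ⟨x, -, rfl⟩ := Finset.mem_image.1 hv
        exact Finset.mem_biUnion.2 ⟨x, x.2, hgN x⟩
      · rw [Finset.card_image_of_injective _ hginj]
        simpa using hJ.2
    intro v hv
    rw [← this] at hv
    simpa using hv
  obtain ⟨j, hj⟩ := hJ.1
  obtain ⟨f, j₀, hj₀, hf, hfj⟩ := hcover (g ⟨j, hj⟩) (Finset.mem_filter.1 (hgN ⟨j, hj⟩)).1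
  -- Matched letters go to their partners and the others follow `f`. The troublesome letter `g ⟨j,
  -- hj⟩` thus leaves the tail direction `j₀`.
  let f' : ℕ → ℕ := fun v => if h : ∃ x, g x = v then (h.choose : J) else f v
  have hf'g : ∀ x, f' (g x) = x := fun x => by
    have h : ∃ y, g y = g x := ⟨x, rfl⟩
    simp only [f', h, dif_pos]
    exact congrArg Subtype.val (hginj h.choose_spec)
  have hf'n : ∀ v, (¬ ∃ x, g x = v) → f' v = f v := fun v h => by simp only [f', h, dif_neg,
    not_false_eq_true]
  refine hbm.1.1.not_avoid f' fun i hi => ?_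
  by_cases hiJ : i ∈ J
  · refine (Finset.mem_filter.1 (hgN ⟨i, hiJ⟩)).2 ((hSd i).of_inter_subset ?_ hi)
    rintro k ⟨⟨hkn, hk⟩, hkS⟩
    by_cases h : ∃ x, g x = k
    · obtain ⟨x, rfl⟩ := h
      rw [hf'g] at hk
      subst hk
      rfl
    · rw [hf'n k h] at hk
      refine absurd (hgsurj k (Finset.mem_biUnion.2 ⟨i, hiJ, Finset.mem_filter.2 ⟨hkS, ?_⟩⟩)) h
      intro hbk
      refine hf i (fun h => hj₀ (h ▸ hJI hiJ)) ((b i).mono ?_ hbk)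
      rintro _ rfl
      exact ⟨hkn, hk⟩
  · have hsub : ∀ k ∈ S, k ∈ fibre n f' i → (¬ ∃ x, g x = k) ∧ k ∈ fibre n f i := by
      rintro k hkS ⟨hkn, hk⟩
      have h : ¬ ∃ x, g x = k := by
        rintro ⟨x, rfl⟩
        exact hiJ (hk ▸ hf'g x ▸ x.2)
      exact ⟨h, hkn, hf'n k h ▸ hk⟩
    by_cases hij : i = j₀
    · subst hij
      refine (b i).not_empty ((hSd i).of_inter_subset ?_ hi)
      rintro k ⟨hk, hkS⟩
      have := hsub k hkS hk
      exact absurd ⟨_, (hfj k hkS this.2).symm⟩ this.1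
    · exact hf i hij ((hSd i).of_inter_subset (fun k hk => (hsub k hk.2 hk.1).2) hi)

/-- The brick has "at least two letters" in `m` directions and "at least one" elsewhere. It is
unavoidable by pigeonhole on `m + 1` letters. -/
lemma minimalActive_range_nonempty (m : ℕ) :
    (minimalActive (m + 1) (Finset.range m)).Nonempty := by
  classical
  obtain ⟨x, hx⟩ : ∃ x : DedekindLattice, 0 < m → ∀ X, x.1 X ↔
      ∃ k < m + 1, ∃ l < m + 1, k ≠ l ∧ k ∈ X ∧ l ∈ X := by
    by_cases hm : 0 < m
    · refine ⟨ofFamily ((Finset.range (m + 1)).powersetCard 2)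
        (Finset.powersetCard_nonempty.2 (by simp; omega)) (fun A hA => Finset.card_pos.1 (by
          rw [(Finset.mem_powersetCard.1 hA).2]; omega)), fun _ X => ?_⟩
      rw [ofFamily_holds]
      constructor
      · rintro ⟨A, hA, hAX⟩
        obtain ⟨hAn, hA⟩ := Finset.mem_powersetCard.1 hA
        obtain ⟨k, l, hkl, rfl⟩ := Finset.card_eq_two.1 hA
        exact ⟨k, by simpa using hAn (by simp : k ∈ _), l, by simpa using hAn (by simp : l ∈ _),
          hkl, hAX (by simp), hAX (by simp)⟩
      · rintro ⟨k, hk, l, hl, hkl, hkX, hlX⟩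
        refine ⟨{k, l}, Finset.mem_powersetCard.2 ⟨?_, Finset.card_pair hkl⟩, ?_⟩
        · simp [Finset.insert_subset_iff, hk, hl]
        · simp [Set.insert_subset_iff, hkX, hlX]
    -- For `m = 0` there is no pair of letters and no active coordinate; any element serves.
    · exact ⟨letter 0, fun h => absurd h hm⟩
  let o := orLetters (Finset.range (m + 1)) (by simp)
  have ho : ∀ X, o.1 X ↔ ∃ k < m + 1, k ∈ X := fun X => by simp [o, orLetters_holds]
  let b : LatticeBrick := fun j => if j < m then x else o
  have hbx : ∀ j < m, b j = x := fun j hj => if_pos hj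
  have hbo : ∀ j, m ≤ j → b j = o := fun j hj => if_neg (not_lt.2 hj)
  have hact : {j | b j ≠ o} = Finset.range m := by
    ext j
    simp only [Set.mem_ofPred_eq, Finset.coe_range, Set.mem_Iio]
    constructor
    · intro h
      by_contra hj
      exact h (hbo j (not_lt.1 hj))
    · intro hj h
      rw [hbx j hj] at h
      have : x.1 {0} := h ▸ (ho {0}).2 ⟨0, by omega, rfl⟩
      obtain ⟨k, -, l, -, hkl, hk, hl⟩ := (hx (by omega) _).1 this
      rw [Set.mem_singleton_iff] at hk hl
      omega
  refine ⟨b, ⟨⟨fun f => ?_, o, hact ▸ Finset.finite_toSet _⟩, ?_⟩, o, hact⟩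
  · by_cases h : ∃ k < m + 1, m ≤ f k
    · obtain ⟨k, hk, hkm⟩ := h
      exact ⟨f k, by rw [hbo _ hkm, ho]; exact ⟨k, hk, hk, rfl⟩⟩
    · push Not at h
      obtain ⟨k, hk, l, hl, hkl, hf⟩ := Finset.exists_ne_map_eq_of_card_lt_of_maps_to
        (s := Finset.range (m + 1)) (t := Finset.range m) (f := f) (by simp)
        (fun k hk => by simpa using h k (by simpa using hk))
      rw [Finset.mem_range] at hk hl
      refine ⟨f k, ?_⟩
      have := h k hk
      rw [hbx _ this, hx (by omega)]
      exact ⟨k, hk, l, hl, hkl, ⟨hk, rfl⟩, hl, hf.symm⟩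
  · intro c hc hcb j X hX
    by_contra hcX
    -- Put just enough letters of `X` in direction `j` to satisfy `b j`. The others then match the
    -- active directions except `j` bijectively, which avoids `b` there.
    obtain ⟨A, hAn, hAX, hA⟩ : ∃ A ⊆ Finset.range (m + 1), (A : Set ℕ) ⊆ X ∧
        (Finset.range (m + 1) \ A).card = ((Finset.range m).erase j).card := by
      by_cases hj : j < m
      · rw [hbx j hj, hx (by omega)] at hX
        obtain ⟨k, hk, l, hl, hkl, hkX, hlX⟩ := hX
        have hsub : ({k, l} : Finset ℕ) ⊆ Finset.range (m + 1) := by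
          simp [Finset.insert_subset_iff, hk, hl]
        refine ⟨{k, l}, hsub, by simp [Set.insert_subset_iff, hkX, hlX], ?_⟩
        rw [Finset.card_sdiff_of_subset hsub, Finset.card_erase_of_mem (by simpa using hj),
          Finset.card_pair hkl]
        simp
      · rw [hbo j (not_lt.1 hj), ho] at hX
        obtain ⟨k, hk, hkX⟩ := hX
        have hsub : ({k} : Finset ℕ) ⊆ Finset.range (m + 1) := by simpa using hk
        refine ⟨{k}, hsub, by simpa using hkX, ?_⟩
        rw [Finset.card_sdiff_of_subset hsub, Finset.erase_eq_of_notMem (by simpa using hj)]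
        simp
    let e := Finset.equivOfCardEq hA
    let f : ℕ → ℕ := fun k =>
      if h : k ∈ Finset.range (m + 1) \ A then (e ⟨k, h⟩ : ℕ) else j
    have hfe : ∀ k (h : k ∈ Finset.range (m + 1) \ A), f k = e ⟨k, h⟩ := fun k h => dif_pos h
    have hfj : ∀ k, k ∉ Finset.range (m + 1) \ A → f k = j := fun k h => dif_neg h
    have hlt : ∀ k ∈ Finset.range (m + 1) \ A, f k ≠ j ∧ f k < m := by
      intro k h
      have := (e ⟨k, h⟩).2
      rw [← hfe k h, Finset.mem_erase, Finset.mem_range] at this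
      exact this
    refine hc.1.not_avoid f fun i hi => ?_
    by_cases hij : i = j
    · subst hij
      refine hcX ((c i).mono ?_ hi)
      rintro k ⟨hk, hki⟩
      by_contra hkX
      exact (hlt k (Finset.mem_sdiff.2 ⟨Finset.mem_range.2 hk, fun h => hkX (hAX h)⟩)).1 hki
    · have hmem : ∀ k ∈ fibre (m + 1) f i, k ∈ Finset.range (m + 1) \ A := by
        rintro k ⟨-, hk⟩
        by_contra h
        exact hij (hk.symm.trans (hfj k h))
      have hbi := hcb i _ hi
      by_cases him : i < m
      · rw [hbx i him, hx (by omega)] at hbi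
        obtain ⟨k, -, l, -, hkl, hk, hl⟩ := hbi
        refine hkl (congrArg Subtype.val (e.injective (a₁ := ⟨k, hmem k hk⟩)
          (a₂ := ⟨l, hmem l hl⟩) (Subtype.ext ?_)))
        rw [← hfe, ← hfe, hk.2, hl.2]
      · rw [hbo i (not_lt.1 him), ho] at hbi
        obtain ⟨k, -, hk⟩ := hbi
        exact him (hk.2 ▸ (hlt k (hmem k hk)).2)

/-! ### Symmetry under permutations of the directions, and the count -/

lemma Unavoidable.comp_perm {n : ℕ} {b : LatticeBrick} (hb : Unavoidable n b)
    (σ : Equiv.Perm ℕ) : Unavoidable n (b ∘ σ) := by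
  intro f
  obtain ⟨i, hi⟩ := hb (σ ∘ f)
  refine ⟨σ.symm i, ?_⟩
  have : fibre n f (σ.symm i) = fibre n (σ ∘ f) i := by
    ext k; simp [fibre, Equiv.eq_symm_apply]
  simpa [this] using hi

lemma IsEventual.comp_perm {n : ℕ} {b : LatticeBrick} (hb : IsEventual n b) (σ : Equiv.Perm ℕ) :
    IsEventual n (b ∘ σ) :=
  ⟨hb.1.comp_perm σ, hb.2.imp fun _ hs => hs.preimage σ.injective.injOn⟩

lemma minimal_comp_perm {n : ℕ} {b : LatticeBrick} (hb : Minimal (IsEventual n) b)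
    (σ : Equiv.Perm ℕ) : Minimal (IsEventual n) (b ∘ σ) := by
  refine ⟨hb.1.comp_perm σ, fun c hc hcb i => ?_⟩
  have := hb.2 (hc.comp_perm σ.symm) (fun j => by simpa using hcb (σ.symm j)) (σ i)
  simpa using this

lemma comp_perm_mem_minimalActive {n : ℕ} {I J : Finset ℕ} {b : LatticeBrick}
    (hb : b ∈ minimalActive n I) (σ : Equiv.Perm ℕ) (hσ : ∀ j, j ∈ J ↔ σ j ∈ I) :
    b ∘ σ ∈ minimalActive n J := by
  obtain ⟨hb, s, hs⟩ := hb
  refine ⟨minimal_comp_perm hb σ, s, ?_⟩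
  ext j
  rw [Finset.mem_coe, hσ, ← Finset.mem_coe, ← hs]
  rfl

lemma exists_perm_mem_iff {I J : Finset ℕ} (h : J.card = I.card) :
    ∃ σ : Equiv.Perm ℕ, ∀ j, j ∈ J ↔ σ j ∈ I := by
  classical
  have hinf : ∀ K : Finset ℕ, Infinite {j // j ∉ K} := fun K =>
    (K.finite_toSet.infinite_compl).to_subtype
  have := hinf I
  have := hinf J
  obtain ⟨e⟩ := nonempty_equiv_of_countable (α := {j // j ∉ J}) (β := {j // j ∉ I})
  refine ⟨Equiv.subtypeCongr (Finset.equivOfCardEq h) e, fun j => ?_⟩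
  by_cases hj : j ∈ J
  · simp [Equiv.subtypeCongr, hj]
  · simpa [Equiv.subtypeCongr, hj] using (e ⟨j, hj⟩).2

lemma ncard_minimalActive_congr (n : ℕ) {I J : Finset ℕ} (h : J.card = I.card) :
    (minimalActive n I).ncard = (minimalActive n J).ncard := by
  obtain ⟨σ, hσ⟩ := exists_perm_mem_iff h
  have himage : minimalActive n J = (fun b : LatticeBrick => b ∘ σ) '' minimalActive n I := by
    ext b
    constructor
    · intro hb
      exact ⟨b ∘ σ.symm, comp_perm_mem_minimalActive hb σ.symm fun j => by simp [hσ],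
        by ext1 j; simp⟩
    · rintro ⟨b, hb, rfl⟩
      exact comp_perm_mem_minimalActive hb σ hσ
  rw [himage, Set.ncard_image_of_injective _ σ.surjective.injective_comp_right]

lemma minimalBricks_finite (n d : ℕ) : (minimalBricks n d).Finite :=
  (good_finite n d).subset fun _ hb => hb.1

lemma mem_minimalBricks_iff_exists {n d : ℕ} {b : LatticeBrick} :
    b ∈ minimalBricks n d ↔ ∃ I ⊆ Finset.range d, b ∈ minimalActive n I := by
  rw [mem_minimalBricks_iff]
  constructor
  · rintro ⟨hb, hd⟩
    refine ⟨hd.finite_ne.toFinset, fun j hj => ?_, hb, b d, by simp⟩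
    rw [Finset.mem_range]
    by_contra hjd
    exact (hd.finite_ne.mem_toFinset.1 hj) (hd j (not_lt.1 hjd))
  · rintro ⟨I, hI, hb, s, hs⟩
    have key : ∀ j, d ≤ j → b j = s := fun j hj => by
      by_contra h
      have : j ∈ (I : Set ℕ) := hs ▸ h
      have := Finset.mem_range.1 (hI this)
      omega
    exact ⟨hb, fun j hj => (key j hj).trans (key d le_rfl).symm⟩

lemma minimalActive_finite (n : ℕ) (I : Finset ℕ) : (minimalActive n I).Finite :=
  (minimalBricks_finite n (I.sup id + 1)).subset fun _ hb => mem_minimalBricks_iff_exists.2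
    ⟨I, fun _ hj => Finset.mem_range.2 (Nat.lt_succ_of_le (Finset.le_sup (f := id) hj)), hb⟩

lemma eq_of_mem_minimalActive {n : ℕ} {I J : Finset ℕ} {b : LatticeBrick}
    (hI : b ∈ minimalActive n I) (hJ : b ∈ minimalActive n J) : I = J := by
  classical
  obtain ⟨-, s, hs⟩ := hI
  obtain ⟨-, t, ht⟩ := hJ
  obtain ⟨j, hj⟩ := Infinite.exists_notMem_finset (I ∪ J)
  rw [Finset.mem_union, not_or, ← Finset.mem_coe, ← Finset.mem_coe, ← hs, ← ht] at hj
  simp only [Set.mem_ofPred_eq, not_not] at hj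
  rw [← Finset.coe_inj, ← hs, ← ht, ← hj.1, ← hj.2]

lemma ncard_minimalBricks (n d : ℕ) :
    (minimalBricks n d).ncard =
      ∑ k ∈ Finset.range n, d.choose k * (minimalActive n (Finset.range k)).ncard := by
  classical
  have hunion : minimalBricks n d =
      ((Finset.range d).powerset.biUnion fun I => (minimalActive_finite n I).toFinset : Finset _) := by
    ext b
    rw [mem_minimalBricks_iff_exists]
    simp only [Finset.coe_biUnion, Set.mem_iUnion, Finset.mem_coe, Finset.mem_powerset,
      exists_prop, Set.Finite.coe_toFinset]
  rw [hunion, Set.ncard_coe_finset, Finset.card_biUnion]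
  · have hcard : ∀ I, (minimalActive_finite n I).toFinset.card =
        (minimalActive n (Finset.range I.card)).ncard := fun I => by
      rw [← Set.ncard_eq_toFinset_card _ (minimalActive_finite n I)]
      exact ncard_minimalActive_congr n (by simp)
    simp only [hcard]
    rw [Finset.sum_powerset_apply_card fun k => (minimalActive n (Finset.range k)).ncard]
    simp only [Finset.card_range, smul_eq_mul]
    have h1 : ∀ k, n ≤ k → (minimalActive n (Finset.range k)).ncard = 0 := by
      intro k hk
      rw [Set.ncard_eq_zero (minimalActive_finite n _), Set.eq_empty_iff_forall_notMem]
      intro b hb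
      have := card_lt_of_mem_minimalActive hb
      rw [Finset.card_range] at this
      omega
    -- Binomials vanish beyond `d` and the counts from `n` on, so both sums extend to the larger
    -- range.
    refine (Finset.sum_subset (Finset.range_mono (le_max_left (d + 1) n)) ?_).trans
      (Finset.sum_subset (Finset.range_mono (le_max_right (d + 1) n)) ?_).symm
    · intro k _ hk
      rw [Nat.choose_eq_zero_of_lt (by simpa using hk), zero_mul]
    · intro k _ hk
      rw [h1 k (by simpa using hk), mul_zero]
  · intro I _ J _ hIJ
    rw [Function.onFun, Finset.disjoint_left]
    intro b hI hJ
    exact hIJ (eq_of_mem_minimalActive (by simpa using hI) (by simpa using hJ))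

/-- The polynomial whose value at `d` is the number of `n,d`-minimal bricks. -/
noncomputable def countPolynomial (n : ℕ) : Polynomial ℚ :=
  ∑ k ∈ Finset.range n,
    Polynomial.C (((minimalActive n (Finset.range k)).ncard : ℚ) / k.factorial) *
      descPochhammer ℚ k

lemma countPolynomial_eval (n d : ℕ) :
    (countPolynomial n).eval (d : ℚ) = ((minimalBricks n d).ncard : ℚ) := by
  rw [ncard_minimalBricks, countPolynomial, Polynomial.eval_finsetSum, Nat.cast_sum]
  refine Finset.sum_congr rfl fun k _ => ?_
  rw [Polynomial.eval_mul, Polynomial.eval_C, Nat.cast_mul, Nat.cast_choose_eq_descPochhammer_div]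
  ring

lemma degree_countPolynomial {n : ℕ} (hn : 1 ≤ n) :
    (countPolynomial n).degree = ((n - 1 : ℕ) : WithBot ℕ) := by
  obtain ⟨m, rfl⟩ := Nat.exists_eq_add_of_le' hn
  have hdeg : ∀ k, (descPochhammer ℚ k).degree = k := fun k => by
    rw [Polynomial.degree_eq_natDegree (monic_descPochhammer ℚ k).ne_zero,
      descPochhammer_natDegree]
  have hlead : (((minimalActive (m + 1) (Finset.range m)).ncard : ℚ) / m.factorial) ≠ 0 := by
    have := (Set.ncard_pos (minimalActive_finite _ _)).2 (minimalActive_range_nonempty m)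
    positivity
  have htop := (Polynomial.degree_C_mul (p := descPochhammer ℚ m) hlead).trans (hdeg m)
  rw [countPolynomial, Finset.sum_range_succ, Polynomial.degree_add_eq_right_of_degree_lt, htop]
  · rfl
  · rw [htop]
    refine (Polynomial.degree_sum_le _ _).trans_lt ((Finset.sup_lt_iff (WithBot.bot_lt_coe m)).2 ?_)
    intro k hk
    refine (Polynomial.degree_mul_le _ _).trans_lt ?_
    rw [hdeg]
    refine (add_le_add_left Polynomial.degree_C_le _).trans_lt ?_
    rw [zero_add]
    exact WithBot.coe_lt_coe.2 (Finset.mem_range.1 hk)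

end LatticeBrick

namespace Brick

/-! ### The span of the translates of the protobricks -/

/-- The indicator function of the translate `h.1 + h.2`. -/
noncomputable def translateIndicator {d : ℕ} (h : Brick d × (Fin d → ℝ)) : (Fin d → ℝ) → ℤ :=
  (h.1.translate h.2).indicator fun _ => 1

/-- The integer combinations of indicator functions of translates of protobricks. -/
noncomputable def tileSpan {d : ℕ} (P : Finset (Brick d)) : Submodule ℤ ((Fin d → ℝ) → ℤ) :=
  Submodule.span ℤ (translateIndicator '' {h | h.1 ∈ P})

lemma tilable_iff_mem_tileSpan {d : ℕ} {P : Finset (Brick d)} {t : Brick d} :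
    Tilable P t ↔ t.region.indicator (fun _ => (1 : ℤ)) ∈ tileSpan P := by
  constructor
  · rintro ⟨s, γ, hs, h⟩
    have : t.region.indicator (fun _ => (1 : ℤ)) = ∑ h ∈ s, γ h • translateIndicator h := by
      funext y
      rw [h y, Finset.sum_apply]
      rfl
    rw [this]
    exact Submodule.sum_mem _ fun h hh =>
      Submodule.smul_mem _ _ (Submodule.subset_span ⟨h, hs h hh, rfl⟩)
  · intro h
    obtain ⟨l, hl, hlt⟩ := (Finsupp.mem_span_image_iff_linearCombination ℤ).1 h
    refine ⟨l.support, l, fun h hh => (Finsupp.mem_supported ℤ l).1 hl hh, fun y => ?_⟩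
    rw [← hlt, Finsupp.linearCombination_apply, Finsupp.sum, Finset.sum_apply]
    rfl

lemma mem_translate_iff {d : ℕ} (b : Brick d) (w y : Fin d → ℝ) :
    y ∈ b.translate w ↔ ∀ i, w i ≤ y i ∧ y i < w i + (b i : ℕ) := by
  constructor
  · rintro ⟨z, hz, rfl⟩ i
    have := hz i
    simp only [Pi.add_apply]
    constructor <;> linarith
  · intro h
    refine ⟨y - w, fun i => ?_, by simp⟩
    have := h i
    simp only [Pi.sub_apply]
    constructor <;> linarith

lemma translate_zero {d : ℕ} (b : Brick d) : b.translate 0 = b.region := by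
  simp [translate]

lemma tilable_of_mem {d : ℕ} {P : Finset (Brick d)} {b : Brick d} (hb : b ∈ P) : Tilable P b :=
  tilable_iff_mem_tileSpan.2
    (Submodule.subset_span ⟨(b, 0), hb, by simp [translateIndicator, translate_zero]⟩)

lemma comp_sub_mem_tileSpan {d : ℕ} {P : Finset (Brick d)} {g : (Fin d → ℝ) → ℤ}
    (hg : g ∈ tileSpan P) (w : Fin d → ℝ) : (fun y => g (y - w)) ∈ tileSpan P := by
  have := Submodule.mem_map_of_mem (f := LinearMap.funLeft ℤ ℤ fun y : Fin d → ℝ => y - w) hg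
  refine (Submodule.map_span_le _ _ _).2 ?_ this
  rintro _ ⟨h, hh, rfl⟩
  refine Submodule.subset_span ⟨(h.1, h.2 + w), hh, funext fun y => ?_⟩
  have : y ∈ h.1.translate (h.2 + w) ↔ y - w ∈ h.1.translate h.2 := by
    rw [mem_translate_iff, mem_translate_iff]
    refine forall_congr' fun i => ?_
    simp only [Pi.add_apply, Pi.sub_apply]
    constructor <;> rintro ⟨h1, h2⟩ <;> constructor <;> linarith
  classical
  simp only [translateIndicator, LinearMap.funLeft_apply]
  rw [Set.indicator_apply, Set.indicator_apply]
  exact if_congr this rfl rfl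

/-- The signed indicator function of the box obtained from `t` by replacing its side in direction
`e` by the interval from `0` to the integer `m`. -/
noncomputable def slab {d : ℕ} (t : Brick d) (e : Fin d) (m : ℤ) : (Fin d → ℝ) → ℤ := fun y =>
  open Classical in
  if ∀ j ≠ e, 0 ≤ y j ∧ y j < (t j : ℕ) then
    (if 0 ≤ y e then 1 else 0) - (if 0 ≤ y e - m then 1 else 0) else 0

/-- Additivity up to translation, including negative lengths, makes the tilable lengths a subgroup
of ℤ. -/
lemma slab_add {d : ℕ} (t : Brick d) (e : Fin d) (m k : ℤ) :
    slab t e (m + k) = slab t e m + fun y => slab t e k (y - Pi.single e (m : ℝ)) := by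
  funext y
  have h : (∀ j ≠ e, 0 ≤ (y - Pi.single e (m : ℝ) : Fin d → ℝ) j ∧
      (y - Pi.single e (m : ℝ) : Fin d → ℝ) j < (t j : ℕ)) ↔
      ∀ j ≠ e, 0 ≤ y j ∧ y j < (t j : ℕ) :=
    forall₂_congr fun j hj => by simp [hj]
  have hm : (y - Pi.single e (m : ℝ) : Fin d → ℝ) e = y e - m := by simp
  simp only [slab, Pi.add_apply, h, hm, Int.cast_add, sub_sub]
  split_ifs <;> simp

lemma slab_zero {d : ℕ} (t : Brick d) (e : Fin d) : slab t e 0 = 0 := by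
  funext y
  simp [slab]

lemma slab_update {d : ℕ} (t : Brick d) (e : Fin d) (a : ℕ+) :
    slab t e (a : ℕ) = (Brick.region (Function.update t e a)).indicator fun _ => 1 := by
  classical
  funext y
  have h : y ∈ Brick.region (Function.update t e a) ↔
      (∀ j ≠ e, 0 ≤ y j ∧ y j < (t j : ℕ)) ∧ 0 ≤ y e ∧ y e < (a : ℕ) := by
    constructor
    · intro h
      exact ⟨fun j hj => by simpa [hj] using h j, by simpa using h e⟩
    · rintro ⟨h1, h2⟩ j
      by_cases hj : j = e
      · subst hj; simpa using h2
      · simpa [hj] using h1 j hj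
  have ha : (0 : ℝ) < (a : ℕ) := by exact_mod_cast a.pos
  rw [Set.indicator_apply]
  simp only [h, slab, Int.cast_natCast, sub_nonneg]
  by_cases h1 : ∀ j ≠ e, 0 ≤ y j ∧ y j < (t j : ℕ)
  · rw [if_pos h1]
    by_cases h2 : 0 ≤ y e
    · by_cases h3 : y e < (a : ℕ)
      · rw [if_pos h2, if_neg (not_le.2 h3), if_pos ⟨h1, h2, h3⟩]; rfl
      · rw [if_pos h2, if_pos (not_lt.1 h3), if_neg fun h => h3 h.2.2]; rfl
    · rw [if_neg h2, if_neg (by linarith), if_neg fun h => h2 h.2.1]; rfl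
  · rw [if_neg h1, if_neg fun h => h1 h.1]

/-- The integers `m` for which the box with side from `0` to `m` in direction `e` is tilable. -/
noncomputable def sideSubgroup {d : ℕ} (P : Finset (Brick d)) (t : Brick d) (e : Fin d) :
    AddSubgroup ℤ where
  carrier := {m | slab t e m ∈ tileSpan P}
  zero_mem' := by
    change slab t e 0 ∈ tileSpan P
    rw [slab_zero]
    exact zero_mem _
  add_mem' {m k} hm hk := by
    change slab t e (m + k) ∈ tileSpan P
    rw [slab_add]
    exact add_mem hm (comp_sub_mem_tileSpan hk _)
  neg_mem' {m} hm := by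
    have h := slab_add t e (-m) m
    rw [neg_add_cancel, slab_zero] at h
    change slab t e (-m) ∈ tileSpan P
    rw [eq_neg_of_add_eq_zero_left h.symm]
    exact neg_mem (comp_sub_mem_tileSpan hm _)

lemma mem_sideSubgroup {d : ℕ} {P : Finset (Brick d)} {t : Brick d} {e : Fin d} {a : ℕ+} :
    ((a : ℕ) : ℤ) ∈ sideSubgroup P t e ↔ Tilable P (Function.update t e a) := by
  rw [tilable_iff_mem_tileSpan, ← slab_update]
  rfl

/-- The subgroup of tilable lengths is cyclic; its generator divides every `a x`, hence their gcd.
-/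
lemma tilable_of_gcd_dvd {d : ℕ} {P : Finset (Brick d)} {t : Brick d} (e : Fin d) {ι : Type*}
    (A : Finset ι) (a : ι → ℕ+) (hA : ∀ x ∈ A, Tilable P (Function.update t e (a x)))
    (h : A.gcd (fun x => (a x : ℕ)) ∣ t e) : Tilable P t := by
  rw [← Function.update_eq_self e t, ← mem_sideSubgroup]
  obtain ⟨g, hg⟩ := Int.subgroup_cyclic (sideSubgroup P t e)
  rw [← AddSubgroup.zmultiples_eq_closure] at hg
  rw [hg, Int.mem_zmultiples_iff, ← Int.natAbs_dvd, Int.natCast_dvd_natCast]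
  refine dvd_trans (Finset.dvd_gcd fun x hx => ?_) h
  have := mem_sideSubgroup.2 (hA x hx)
  rwa [hg, Int.mem_zmultiples_iff, ← Int.natAbs_dvd, Int.natCast_dvd_natCast] at this

lemma Tilable.of_divides {d : ℕ} {P : Finset (Brick d)} {b t : Brick d} (hb : Tilable P b)
    (h : b.Divides t) : Tilable P t := by
  classical
  have key : ∀ s : Finset (Fin d), Tilable P (s.piecewise t b) := by
    intro s
    induction s using Finset.induction_on with
    | empty => simpa using hb
    | insert e s he ih =>
      refine tilable_of_gcd_dvd e {()} (fun _ => b e) (fun _ _ => ?_) (by simpa using h e)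
      convert! ih using 1
      funext j
      by_cases hj : j = e
      · subst hj; simp [he]
      · simp [hj, Finset.piecewise]
  simpa using key Finset.univ

/-! ### Obstructions to tilability -/

lemma sum_Ico_int_sub (ψ : ℤ → ℤ) (a : ℤ) (n : ℕ) :
    ∑ x ∈ Finset.Ico a (a + n), (ψ x - ψ (x + 1)) = ψ a - ψ (a + n) := by
  rw [Int.Ico_eq_finset_map, Finset.sum_map]
  simp only [add_sub_cancel_left, Int.toNat_natCast, Function.Embedding.trans_apply,
    Nat.castEmbedding_apply, addLeftEmbedding_apply]
  have := Finset.sum_range_sub' (fun k : ℕ => ψ (a + k)) n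
  simpa [add_assoc] using this

/-- Only integer points are sampled. The weight is a product of differences, so the sum over a box
factors and telescopes in each direction. -/
lemma sum_weight_mul_indicator {d : ℕ} (ψ : Fin d → ℤ → ℤ) (V : Fin d → Finset ℤ) (b : Brick d)
    (w : Fin d → ℝ) (hV : ∀ i, Finset.Ico ⌈w i⌉ (⌈w i⌉ + (b i : ℕ)) ⊆ V i) :
    ∑ y ∈ Fintype.piFinset V, (∏ i, (ψ i (y i) - ψ i (y i + 1))) *
        (b.translate w).indicator (fun _ => (1 : ℤ)) (fun i => (y i : ℝ)) =
      ∏ i, (ψ i ⌈w i⌉ - ψ i (⌈w i⌉ + (b i : ℕ))) := by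
  classical
  have hind : ∀ y : Fin d → ℤ, (b.translate w).indicator (fun _ => (1 : ℤ)) (fun i => (y i : ℝ)) =
      ∏ i, if y i ∈ Finset.Ico ⌈w i⌉ (⌈w i⌉ + (b i : ℕ)) then 1 else 0 := by
    intro y
    have hmem : (fun i => (y i : ℝ)) ∈ b.translate w ↔
        ∀ i, y i ∈ Finset.Ico ⌈w i⌉ (⌈w i⌉ + (b i : ℕ)) := by
      rw [mem_translate_iff]
      refine forall_congr' fun i => ?_
      rw [Finset.mem_Ico, ← Int.ceil_add_natCast, Int.ceil_le, Int.lt_ceil]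
    by_cases h : ∀ i, y i ∈ Finset.Ico ⌈w i⌉ (⌈w i⌉ + (b i : ℕ))
    · rw [Set.indicator_of_mem (hmem.2 h), Finset.prod_eq_one fun i _ => if_pos (h i)]
    · rw [Set.indicator_of_notMem (mt hmem.1 h)]
      obtain ⟨i, hi⟩ := not_forall.1 h
      rw [Finset.prod_eq_zero (Finset.mem_univ i) (if_neg hi)]
  simp only [hind, ← Finset.prod_mul_distrib]
  rw [← Finset.prod_univ_sum V fun i x => (ψ i x - ψ i (x + 1)) *
    if x ∈ Finset.Ico ⌈w i⌉ (⌈w i⌉ + (b i : ℕ)) then 1 else 0]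
  refine Finset.prod_congr rfl fun i _ => ?_
  simp only [mul_ite, mul_one, mul_zero]
  rw [Finset.sum_ite_mem, Finset.inter_eq_right.2 (hV i), sum_Ico_int_sub]

/-- If every protobrick has a side that is a multiple of the corresponding modulus, then so has every
tilable brick. -/
lemma Tilable.exists_dvd {d : ℕ} {P : Finset (Brick d)} {t : Brick d} (ht : Tilable P t)
    (m : Fin d → ℕ) (h : ∀ b ∈ P, ∃ i, m i ∣ b i) : ∃ i, m i ∣ t i := by
  classical
  by_contra! hm
  obtain ⟨s, γ, hs, hst⟩ := ht
  -- With this `ψ`, a translate contributes 0 once one side is a multiple of its modulus, while `t`,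
  -- placed at the origin with no such side, contributes 1.
  let ψ : Fin d → ℤ → ℤ := fun i x => if (m i : ℤ) ∣ x then 1 else 0
  let I : Brick d → (Fin d → ℝ) → Fin d → Finset ℤ := fun b w i =>
    Finset.Ico ⌈w i⌉ (⌈w i⌉ + (b i : ℕ))
  let V : Fin d → Finset ℤ := fun i => I t 0 i ∪ s.biUnion fun h => I h.1 h.2 i
  have hsum := sum_weight_mul_indicator ψ V t 0 fun i => Finset.subset_union_left
  simp only [translate_zero, hst, Finset.mul_sum] at hsum
  rw [Finset.sum_comm, Finset.sum_eq_zero, Finset.prod_congr rfl, Finset.prod_const_one] at hsum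
  · exact zero_ne_one hsum
  · intro i _
    have : ¬ (m i : ℤ) ∣ (t i : ℕ) := fun h => hm i (Int.natCast_dvd_natCast.1 h)
    simp [ψ, this]
  · intro h' hh'
    have := sum_weight_mul_indicator ψ V h'.1 h'.2 fun i =>
      (Finset.subset_biUnion_of_mem (fun h : Brick d × (Fin d → ℝ) => I h.1 h.2 i) hh').trans
        Finset.subset_union_right
    simp only [mul_left_comm _ (γ h'), ← Finset.mul_sum]
    rw [this]
    obtain ⟨i, hi⟩ := h h'.1 (hs h' hh')
    rw [Finset.prod_eq_zero (Finset.mem_univ i), mul_zero]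
    have hdvd : (m i : ℤ) ∣ (h'.1 i : ℕ) := Int.natCast_dvd_natCast.2 hi
    simp only [ψ, dvd_add_left hdvd, sub_self]

/-! ### Evaluation of lattice bricks at protobricks -/

open DedekindLattice LatticeBrick

lemma prime_pow_dvd_lcm {ι : Type*} {p a : ℕ} (hp : p.Prime) (ha : a ≠ 0) (s : Finset ι)
    (f : ι → ℕ) (hf : ∀ x ∈ s, f x ≠ 0) : p ^ a ∣ s.lcm f ↔ ∃ x ∈ s, p ^ a ∣ f x := by
  classical
  refine ⟨fun h => ?_, fun ⟨x, hx, h⟩ => h.trans (Finset.dvd_lcm hx)⟩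
  induction s using Finset.induction_on with
  | empty =>
    rw [Finset.lcm_empty, Nat.dvd_one, Nat.pow_eq_one] at h
    exact absurd h (by simp [hp.ne_one, ha])
  | insert x s _ ih =>
    rw [Finset.forall_mem_insert] at hf
    rw [Finset.lcm_insert] at h
    have h0 : s.lcm f ≠ 0 := fun h0 => by
      obtain ⟨y, hy, hy0⟩ := Finset.lcm_eq_zero_iff.1 h0
      exact hf.2 y hy hy0
    rw [lcm_eq_nat_lcm, hp.pow_dvd_iff_le_factorization (Nat.lcm_ne_zero hf.1 h0),
      Nat.factorization_lcm hf.1 h0, Finsupp.sup_apply, le_sup_iff,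
      ← hp.pow_dvd_iff_le_factorization hf.1, ← hp.pow_dvd_iff_le_factorization h0] at h
    obtain h | h := h
    · exact ⟨x, Finset.mem_insert_self _ _, h⟩
    · obtain ⟨y, hy, h⟩ := ih hf.2 h
      exact ⟨y, Finset.mem_insert_of_mem hy, h⟩

/-- The value of the lattice polynomial `x` in the first `n` letters at the positive integers `v`,
with greatest common divisors as infima and least common multiples as suprema. -/
noncomputable def evalNat (n : ℕ) (v : ℕ → ℕ+) (x : DedekindLattice) : ℕ :=
  open Classical in
  ((Finset.range n).powerset.filter fun A : Finset ℕ => x.1 A).lcm fun A => A.gcd fun k => (v k : ℕ)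

lemma mem_evalNat_index {n : ℕ} {x : DedekindLattice} {A : Finset ℕ} :
    (open Classical in A ∈ (Finset.range n).powerset.filter fun A : Finset ℕ => x.1 A) ↔
      A ⊆ Finset.range n ∧ x.1 A := by
  simp

lemma gcd_ne_zero_of_holds {v : ℕ → ℕ+} {x : DedekindLattice} {A : Finset ℕ} (hA : x.1 A) :
    A.gcd (fun k => (v k : ℕ)) ≠ 0 := by
  obtain rfl | ⟨k, hk⟩ := A.eq_empty_or_nonempty
  · exact absurd (by simpa using hA) x.not_empty
  · exact fun h => (v k).ne_zero (Finset.gcd_eq_zero_iff.1 h k hk)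

lemma evalNat_ne_zero (n : ℕ) (v : ℕ → ℕ+) (x : DedekindLattice) : evalNat n v x ≠ 0 := by
  intro h
  obtain ⟨A, hA, hA0⟩ := Finset.lcm_eq_zero_iff.1 h
  exact gcd_ne_zero_of_holds (mem_evalNat_index.1 hA).2 hA0

/-- Divisibility by a nontrivial prime power turns gcd into "and" and lcm into "or", so it evaluates
the Boolean function. -/
lemma prime_pow_dvd_evalNat {n : ℕ} {v : ℕ → ℕ+} {x : DedekindLattice} {p a : ℕ} (hp : p.Prime)
    (ha : a ≠ 0) : p ^ a ∣ evalNat n v x ↔ x.1 {k | k < n ∧ p ^ a ∣ v k} := by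
  classical
  rw [evalNat, prime_pow_dvd_lcm hp ha _ _
    fun A hA => gcd_ne_zero_of_holds (mem_evalNat_index.1 hA).2]
  constructor
  · rintro ⟨A, hA, hdvd⟩
    obtain ⟨hAn, hA⟩ := mem_evalNat_index.1 hA
    exact x.mono (fun k hk => ⟨Finset.mem_range.1 (hAn hk), Finset.dvd_gcd_iff.1 hdvd k hk⟩) hA
  · intro h
    refine ⟨(Finset.range n).filter fun k => p ^ a ∣ v k,
      mem_evalNat_index.2 ⟨Finset.filter_subset _ _, ?_⟩,
      Finset.dvd_gcd fun k hk => (Finset.mem_filter.1 hk).2⟩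
    simpa using h

lemma evalNat_dvd_evalNat {n : ℕ} {v : ℕ → ℕ+} {x y : DedekindLattice} (h : x ≤ y) :
    evalNat n v x ∣ evalNat n v y :=
  Finset.lcm_dvd fun A hA => Finset.dvd_lcm (f := fun A : Finset ℕ => A.gcd fun k => (v k : ℕ))
    (mem_evalNat_index.2 ((mem_evalNat_index.1 hA).imp id (h A)))

/-- The brick obtained from the first `d` coordinates of a lattice brick by substituting `B k` for
the `k`-th letter. -/
noncomputable def evalBrick {d : ℕ} (n : ℕ) (B : ℕ → Brick d) (b : LatticeBrick) : Brick d :=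
  fun i => ⟨evalNat n (fun k => B k i) (b i), Nat.pos_of_ne_zero (evalNat_ne_zero _ _ _)⟩

lemma evalBrick_coe {d : ℕ} (n : ℕ) (B : ℕ → Brick d) (b : LatticeBrick) (i : Fin d) :
    (evalBrick n B b i : ℕ) = evalNat n (fun k => B k i) (b i) := rfl

/-- A combine becomes a gcd in one direction and lcms in the others: first enlarge the other sides
to multiples, then apply `tilable_of_gcd_dvd`. -/
lemma tilable_evalBrick {d n : ℕ} (B : ℕ → Brick d) {e : ℕ} (he : e ≤ d) {b : LatticeBrick}
    (hb : b ∈ good n e) : Tilable ((Finset.range n).image B) (evalBrick n B b) := by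
  classical
  induction e generalizing b with
  | zero =>
    obtain ⟨k, hk, rfl⟩ := hb
    refine (tilable_of_mem (Finset.mem_image_of_mem B (Finset.mem_range.2 hk))).of_divides
      fun i => ?_
    have := Finset.dvd_lcm (f := fun A : Finset ℕ => A.gcd fun k => (B k i : ℕ))
      (mem_evalNat_index (n := n) (x := letter k) (A := {k}).2
        ⟨by simpa using hk, by simp [letter_holds]⟩)
    rw [Finset.gcd_singleton, normalize_eq] at this
    exact this
  | succ e ih =>
    obtain ⟨A, hA, hAS, rfl⟩ := hb
    refine tilable_of_gcd_dvd ⟨e, he⟩ A (fun a => evalBrick n B a ⟨e, he⟩) (fun a ha => ?_) ?_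
    · refine (ih (by omega) (hAS ha)).of_divides fun i => ?_
      by_cases hi : i = ⟨e, he⟩
      · subst hi; simp
      · rw [Function.update_of_ne hi]
        rw [evalBrick_coe, evalBrick_coe]
        refine evalNat_dvd_evalNat (v := fun k => B k i) fun X hX => ?_
        exact (comb_ne_holds (fun h => hi (Fin.ext h)) A hA X).2 ⟨a, ha, hX⟩
    · rw [Nat.dvd_iff_prime_pow_dvd_dvd]
      intro p a hp hdvd
      obtain rfl | ha := eq_or_ne a 0
      · simp
      · rw [evalBrick_coe]
        refine (prime_pow_dvd_evalNat hp ha).2 ((comb_self_holds e A hA _).2 fun b hb => ?_)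
        exact (prime_pow_dvd_evalNat hp ha).1 (Finset.dvd_gcd_iff.1 hdvd b hb)

lemma Tilable.exists_evalBrick_divides {d n : ℕ} (hn : 1 ≤ n) {B : ℕ → Brick d} {t : Brick d}
    (ht : Tilable ((Finset.range n).image B) t) :
    ∃ b ∈ minimalBricks n d, (evalBrick n B b).Divides t := by
  classical
  -- The moduli are the gcds over the fibres of `f`, so protobrick `k` has a divisible side in
  -- direction `f k`.
  have hf : ∀ f : ℕ → ℕ, (∀ k < n, f k < d) → ∃ i : Fin d,
      ((Finset.range n).filter fun k => f k = i).gcd (fun k => (B k i : ℕ)) ∣ t i := by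
    intro f hfd
    refine ht.exists_dvd _ fun b hb => ?_
    obtain ⟨k, hk, rfl⟩ := Finset.mem_image.1 hb
    exact ⟨⟨f k, hfd k (Finset.mem_range.1 hk)⟩, Finset.gcd_dvd (f := fun k => (B k _ : ℕ))
      (Finset.mem_filter.2 ⟨hk, rfl⟩)⟩
  -- The gcd over the empty set is 0, which divides no positive side.
  have hne : ∀ (i : Fin d) (A : Finset ℕ), A.gcd (fun k => (B k i : ℕ)) ∣ t i → A.Nonempty := by
    intro i A hA
    rw [Finset.nonempty_iff_ne_empty]
    rintro rfl
    simp at hA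
  have hx : ∀ i : Fin d, ∃ x : DedekindLattice, ∀ X, x.1 X ↔ ∃ A ⊆ Finset.range n,
      (A : Set ℕ) ⊆ X ∧ A.gcd (fun k => (B k i : ℕ)) ∣ t i := by
    intro i
    have hrange : (Finset.range n).gcd (fun k => (B k i : ℕ)) ∣ t i := by
      obtain ⟨j, hj⟩ := hf (fun _ => i) fun _ _ => i.2
      obtain ⟨k, hk⟩ := hne j _ hj
      obtain rfl : i = j := Fin.ext (Finset.mem_filter.1 hk).2
      simpa using hj
    have hF : ((Finset.range n).powerset.filter fun A =>
        A.gcd (fun k => (B k i : ℕ)) ∣ (t i : ℕ)).Nonempty :=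
      ⟨Finset.range n, by simpa using hrange⟩
    refine ⟨ofFamily _ hF
      (fun A hA => hne i A (Finset.mem_filter.1 hA).2), fun X => ?_⟩
    rw [ofFamily_holds]
    simp only [Finset.mem_filter, Finset.mem_powerset]
    exact exists_congr fun A => by tauto
  choose x hx using hx
  have ho := orLetters_holds (Finset.range n) (by simpa using (by omega : n ≠ 0))
  set o := orLetters (Finset.range n) (by simpa using (by omega : n ≠ 0))
  -- Coordinate `i` of `τ` records which sets of letters have gcd dividing `t i`; the tail is the
  -- weakest choice, so letters sent there cause no obstruction.
  let τ : LatticeBrick := fun j => if h : j < d then x ⟨j, h⟩ else o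
  have hτx : ∀ i : Fin d, τ i = x i := fun i => dif_pos i.2
  have hτo : ∀ j, d ≤ j → τ j = o := fun j hj => dif_neg (not_lt.2 hj)
  have hτ : Unavoidable n τ := by
    intro f
    by_cases hfd : ∃ k < n, d ≤ f k
    · obtain ⟨k, hk, hkd⟩ := hfd
      exact ⟨f k, by rw [hτo _ hkd, ho]; exact ⟨k, Finset.mem_range.2 hk, hk, rfl⟩⟩
    · push Not at hfd
      obtain ⟨i, hi⟩ := hf f hfd
      refine ⟨i, ?_⟩
      rw [hτx, hx]
      exact ⟨_, Finset.filter_subset _ _, fun k hk => by simpa [fibre] using hk, hi⟩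
  obtain ⟨b, hb, hbτ⟩ := hτ.exists_minimalBricks_le (d := d)
    fun j hj => (hτo j hj).trans (hτo d le_rfl).symm
  refine ⟨b, hb, fun i => ?_⟩
  rw [evalBrick_coe]
  refine Finset.lcm_dvd fun A hA => ?_
  have hτA := hbτ i _ (mem_evalNat_index.1 hA).2
  rw [hτx, hx] at hτA
  obtain ⟨A', -, hA', hdvd⟩ := hτA
  exact (Finset.gcd_mono (Finset.coe_subset.1 hA')).trans hdvd

/-! ### The upper bound for the rank -/

lemma Divides.antisymm {d : ℕ} {b t : Brick d} (h : b.Divides t) (h' : t.Divides b) : b = t :=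
  funext fun i => PNat.eq (Nat.dvd_antisymm (h i) (h' i))

lemma minimalTilable_subset_image {d n : ℕ} (hn : 1 ≤ n) (B : ℕ → Brick d) :
    minimalTilable ((Finset.range n).image B) ⊆ evalBrick n B '' minimalBricks n d := by
  rintro t ⟨ht, hmin⟩
  obtain ⟨b, hb, hbt⟩ := ht.exists_evalBrick_divides hn
  exact ⟨b, hb, hmin _ (tilable_evalBrick B le_rfl hb.1) hbt⟩

lemma rank_le {d n : ℕ} (hn : 1 ≤ n) {P : Finset (Brick d)} (hP : P.card = n) :
    rank P ≤ (minimalBricks n d).encard := by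
  classical
  let e := P.equivFinOfCardEq hP
  let B : ℕ → Brick d := fun k => if h : k < n then (e.symm ⟨k, h⟩ : Brick d) else 1
  have hB : (Finset.range n).image B = P := by
    ext b
    simp only [Finset.mem_image, Finset.mem_range]
    constructor
    · rintro ⟨k, hk, rfl⟩
      simp only [B, hk, dif_pos]
      exact (e.symm _).2
    · intro hb
      exact ⟨e ⟨b, hb⟩, (e ⟨b, hb⟩).2, by simp [B]⟩
  rw [← hB]
  exact (Set.encard_le_encard (minimalTilable_subset_image hn B)).trans (Set.encard_image_le _ _)

/-! ### Protobricks in general position -/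

/-- A prime number attached to each finite set of letters. -/
noncomputable def letterPrime (S : Finset ℕ) : ℕ := Nat.nth Nat.Prime (Encodable.encode S)

lemma letterPrime_prime (S : Finset ℕ) : (letterPrime S).Prime := Nat.prime_nth_prime _

lemma letterPrime_injective : Function.Injective letterPrime :=
  (Nat.nth_injective Nat.infinite_setOfPred_prime).comp Encodable.encode_injective

/-- The product of the primes attached to the sets of letters below `n` that contain `k`. -/
noncomputable def freeSide (n k : ℕ) : ℕ+ :=
  ⟨∏ S ∈ (Finset.range n).powerset.filter (k ∈ ·), letterPrime S,
    Finset.prod_pos fun S _ => (letterPrime_prime S).pos⟩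

lemma letterPrime_dvd_freeSide {n k : ℕ} {S : Finset ℕ} (hS : S ⊆ Finset.range n) :
    letterPrime S ∣ freeSide n k ↔ k ∈ S := by
  rw [freeSide, PNat.mk_coe, (letterPrime_prime S).prime.dvd_finsetProd_iff]
  constructor
  · rintro ⟨T, hT, hST⟩
    rw [Nat.prime_dvd_prime_iff_eq (letterPrime_prime S) (letterPrime_prime T)] at hST
    exact letterPrime_injective hST ▸ (Finset.mem_filter.1 hT).2
  · intro hk
    exact ⟨S, by simp [hS, hk], dvd_rfl⟩

/-- The cube whose sides are `freeSide n k`. -/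
noncomputable def freeBrick (n d k : ℕ) : Brick d := fun _ => freeSide n k

/-- The prime attached to a set of letters divides exactly the sides indexed by that set, so it
tests a coordinate at that assignment. -/
lemma le_of_evalBrick_divides {n d : ℕ} {b c : LatticeBrick} (hb : b ∈ good n d)
    (h : (evalBrick n (freeBrick n d) b).Divides (evalBrick n (freeBrick n d) c)) :
    ∀ i < d, b i ≤ c i := by
  classical
  intro i hi X hX
  obtain ⟨S, hSn, -, hdep, -⟩ := exists_support_of_mem_good hb
  have key : ∀ x : DedekindLattice,
      letterPrime (S.filter (· ∈ X)) ∣ evalNat n (freeSide n) x ↔ x.1 (S.filter (· ∈ X)) := by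
    intro x
    have hsub := (Finset.filter_subset (· ∈ X) S).trans hSn
    have := prime_pow_dvd_evalNat (n := n) (v := freeSide n) (x := x)
      (letterPrime_prime (S.filter (· ∈ X))) one_ne_zero
    rw [pow_one] at this
    rw [this]
    simp only [letterPrime_dvd_freeSide hsub]
    have hset : {k | k < n ∧ k ∈ S.filter (· ∈ X)} = (S.filter (· ∈ X) : Set ℕ) := by
      ext k
      exact ⟨fun h => h.2, fun h => ⟨Finset.mem_range.1 (hsub h), h⟩⟩
    rw [hset]
  have hbX : (b i).1 (S.filter (· ∈ X)) :=
    (hdep i).of_inter_subset (fun k hk => by simpa using And.symm hk) hX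
  have hcX := (key (c i)).1 (((key (b i)).2 hbX).trans (h ⟨i, hi⟩))
  exact (c i).mono (fun k hk => (Finset.mem_filter.1 hk).2) hcX

lemma freeBrick_injOn {n d : ℕ} (hd : 0 < d) :
    Set.InjOn (freeBrick n d) (Finset.range n : Set ℕ) := by
  intro k hk l _ hkl
  have hkl : freeSide n k = freeSide n l := congrFun hkl ⟨0, hd⟩
  have hsub : {k} ⊆ Finset.range n := by simpa using hk
  have := (letterPrime_dvd_freeSide (k := k) hsub).2 (Finset.mem_singleton_self k)
  rw [hkl, letterPrime_dvd_freeSide hsub, Finset.mem_singleton] at this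
  exact this.symm

/-- The values of minimal bricks are pairwise incomparable for divisibility, and every tilable box
is a multiple of one of them. -/
lemma rank_freeBrick {n d : ℕ} (hn : 1 ≤ n) (hd : 2 ≤ d) :
    rank ((Finset.range n).image (freeBrick n d)) = (minimalBricks n d).encard := by
  have hinj : Set.InjOn (evalBrick n (freeBrick n d)) (minimalBricks n d) := fun b hb c hc hbc =>
    eq_of_forall_lt_le hd hb hc
      (le_of_evalBrick_divides hb.1 (hbc ▸ fun _ => dvd_rfl))
  rw [rank, ← hinj.encard_image]
  congr 1
  refine (minimalTilable_subset_image hn _).antisymm ?_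
  rintro _ ⟨b, hb, rfl⟩
  refine ⟨tilable_evalBrick _ le_rfl hb.1, fun t ht htb => htb.antisymm ?_⟩
  obtain ⟨c, hc, hct⟩ := ht.exists_evalBrick_divides hn
  have hcb := eq_of_forall_lt_le hd hc hb
    (le_of_evalBrick_divides hc.1 fun i => (hct i).trans (htb i))
  exact hcb ▸ hct

lemma isMaxrank {n d : ℕ} (hn : 1 ≤ n) (hd : 2 ≤ d) :
    IsMaxrank n d (minimalBricks n d).encard := by
  refine ⟨⟨_, ?_, rank_freeBrick hn hd⟩, ?_⟩
  · rw [Finset.card_image_of_injOn (freeBrick_injOn (by omega)), Finset.card_range]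
  · rintro _ ⟨P, hP, rfl⟩
    exact rank_le hn hP

end Brick

theorem mainTheorem1 (n : ℕ) (hn : 1 ≤ n) :
    ∃ p : Polynomial ℚ, p.degree = ((n - 1 : ℕ) : WithBot ℕ) ∧
      (∀ d : ℕ, 2 ≤ d →
        ∃ r : ℕ, Brick.IsMaxrank n d (r : ℕ∞) ∧ (r : ℚ) = p.eval (d : ℚ)) ∧
      (∀ d : ℕ,
        (LatticeBrick.minimalBricks n d).Finite ∧
          ((LatticeBrick.minimalBricks n d).ncard : ℚ) = p.eval (d : ℚ)) := by
  refine ⟨LatticeBrick.countPolynomial n, LatticeBrick.degree_countPolynomial hn, fun d hd => ?_,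
    fun d => ⟨LatticeBrick.minimalBricks_finite n d,
      (LatticeBrick.countPolynomial_eval n d).symm⟩⟩
  refine ⟨(LatticeBrick.minimalBricks n d).ncard, ?_,
    (LatticeBrick.countPolynomial_eval n d).symm⟩
  rw [(LatticeBrick.minimalBricks_finite n d).cast_ncard_eq]
  exact Brick.isMaxrank hn hd
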